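/- Let $M$ be a smooth $n$-manifold with a smooth symmetric nondegenerate metric $a\cdot b$ of arbitrary signature, let $U\subseteq M$ be open, and let $GT_pM$ denote the geometric (Clifford) algebra of $T_pM$, in which $vv=v\cdot v$ for $v\in T_pM$. A multivector field is smooth if its coefficients in the frames $E_J=E_{j_0}\wedge\dots\wedge E_{j_m}$ ($j_0<\dots<j_m$) built from coordinate vector fields $E_i$ are smooth. A multivector directional derivative (MDD) $D$ on $U$ assigns, at each $p\in U$, to a tangent vector $a\in T_pM$ and a multivector field $A$ that is defined and smooth near $p$ an element $D_aA\in GT_pM$, such that (i) $D_aA$ is linear in $a$; (ii) $D_a\varphi=\partial_a\varphi$ for scalar fields $\varphi$; (iii) $D_av$ is a vector for every vector field $v$; (iv) $D_a(A+B)=D_aA+D_aB$; (v) $D_a(AB)=(D_aA)B+A(D_aB)$. It is torsion-free if $D_ab-D_ba-[a,b]=0$ for all smooth vector fields $a,b$. It is called smooth if $D_aA$ is a smooth field whenever the vector field $a$ and the multivector field $A$ are smooth. Let $e_1,\dots,e_n$ be an arbitrary smooth frame of vector fields on $U$, with reciprocal frame $e^i$ ($e^i\cdot e_j=\delta^i_j$),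 $g_{ij}=e_i\cdot e_j$, and $[e_i,e_j]=\sum_k L_{ijk}e^k$. For an MDD $D$ on $U$, the connection coefficients $\Gamma_{ijk}$ and contorsion coefficients $\chi_{ijk}$ are the functions on $U$ defined by $$D_{e_i}e_j=\sum_k\Gamma_{ijk}\,e^k,\qquad \Gamma_{ijk}=\tfrac12\left(\partial_{e_i}g_{jk}-\partial_{e_k}g_{ij}+\partial_{e_j}g_{ki}\right)+\tfrac12\left(L_{ijk}-L_{jki}+L_{kij}\right)+\chi_{ijk}.$$ 1. Every MDD on $U$ has unique connection coefficients, they satisfy $\Gamma_{ijk}+\Gamma_{ikj}=\partial_{e_i}g_{jk}$, and for every family of functions $\Gamma_{ijk}$ on $U$ with this property there is exactly one MDD on $U$ with connection coefficients $\Gamma_{ijk}$. The MDD is smooth if and only if all $\Gamma_{ijk}$ are smooth. 2. Equivalently, every MDD on $U$ has unique contorsion coefficients, they satisfy $\chi_{ijk}+\chi_{ikj}=0$, and for every family of functions $\chi_{ijk}$ on $U$ with this property there is exactly one MDD on $U$ with contorsion coefficients $\chi_{ijk}$. The MDD is smooth if and only if all $\chi_{ijk}$ are smooth, and it is torsion-free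 if and only if $\chi_{ijk}=0$ for all $i,j,k$. 3. On every open set $U\subseteq M$ (whether or not it admits a frame; in particular on $U=M$) there is exactly one torsion-free MDD $\nabla$. It is smooth, and in every smooth frame $e_i$ on every open $V\subseteq U$ it has $\chi_{ijk}=0$, that is, its connection coefficients are the Levi-Civita coefficients $$\Gamma_{ijk}=\tfrac12\left(\partial_{e_i}g_{jk}-\partial_{e_k}g_{ij}+\partial_{e_j}g_{ki}\right)+\tfrac12\left(L_{ijk}-L_{jki}+L_{kij}\right).$$ -/

import Mathlib

open scoped Manifold ContDiff

noncomputable section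

/-- A smooth pseudo-Riemannian metric on an `n`-manifold (without boundary): a smooth field of
symmetric nondegenerate bilinear forms on the tangent spaces, of arbitrary signature. -/
structure PseudoRiemannianMetric (n : ℕ) (M : Type*) [TopologicalSpace M]
    [ChartedSpace (EuclideanSpace ℝ (Fin n)) M] [IsManifold (𝓡 n) ∞ M] where
  inner (x : M) : TangentSpace (𝓡 n) x →L[ℝ] TangentSpace (𝓡 n) x →L[ℝ] ℝ
  symm (x : M) (v w : TangentSpace (𝓡 n) x) : inner x v w = inner x w v
  nondegenerate (x : M) (v : TangentSpace (𝓡 n) x) (hv : ∀ w, inner x v w = 0) : v = 0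
  contMDiff : ContMDiff (𝓡 n)
    ((𝓡 n).prod 𝓘(ℝ, EuclideanSpace ℝ (Fin n) →L[ℝ] EuclideanSpace ℝ (Fin n) →L[ℝ] ℝ)) ∞
    (fun x ↦ Bundle.TotalSpace.mk'
      (EuclideanSpace ℝ (Fin n) →L[ℝ] EuclideanSpace ℝ (Fin n) →L[ℝ] ℝ)
      (E := fun x : M ↦ TangentSpace (𝓡 n) x →L[ℝ] TangentSpace (𝓡 n) x →L[ℝ] ℝ) x (inner x))

/-- A (locally given) scalar field is smooth in a neighbourhood of `p`. -/
def ScalarSmoothNear {n : ℕ} {M : Type*} [TopologicalSpace M]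
    [ChartedSpace (EuclideanSpace ℝ (Fin n)) M] (φ : M → ℝ) (p : M) : Prop :=
  ∃ W : Set M, IsOpen W ∧ p ∈ W ∧ ContMDiffOn (𝓡 n) 𝓘(ℝ, ℝ) ∞ φ W

/-- A (locally given) vector field is smooth in a neighbourhood of `p`. -/
def VectorSmoothNear {n : ℕ} {M : Type*} [TopologicalSpace M]
    [ChartedSpace (EuclideanSpace ℝ (Fin n)) M] [IsManifold (𝓡 n) ∞ M]
    (v : (x : M) → TangentSpace (𝓡 n) x) (p : M) : Prop :=
  ∃ W : Set M, IsOpen W ∧ p ∈ W ∧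
    ContMDiffOn (𝓡 n) (𝓡 n).tangent ∞ (fun x ↦ (⟨x, v x⟩ : TangentBundle (𝓡 n) M)) W

/-- The `i`-th coordinate vector field of the chart at `p` (meaningful on the chart domain). -/
def coordVector {n : ℕ} {M : Type*} [TopologicalSpace M]
    [ChartedSpace (EuclideanSpace ℝ (Fin n)) M] (p : M) (i : Fin n) (x : M) :
    TangentSpace (𝓡 n) x :=
  (mfderiv 𝓘(ℝ, EuclideanSpace ℝ (Fin n)) (𝓡 n) (extChartAt (𝓡 n) p).symm
    (extChartAt (𝓡 n) p x) (EuclideanSpace.single i (1 : ℝ)) : EuclideanSpace ℝ (Fin n))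

namespace PseudoRiemannianMetric

variable {n : ℕ} {M : Type*} [TopologicalSpace M]
  [ChartedSpace (EuclideanSpace ℝ (Fin n)) M] [IsManifold (𝓡 n) ∞ M]
  (g : PseudoRiemannianMetric n M)

/-- The quadratic form `v ↦ v · v` on the tangent space at `x`. -/
def quadraticForm (x : M) : QuadraticForm ℝ (TangentSpace (𝓡 n) x) :=
  LinearMap.BilinMap.toQuadraticMap (g.inner x).toLinearMap₁₂

/-- The geometric tangent space at `x`: the geometric (Clifford) algebra of the tangent space, in
which `v * v = v · v` for tangent vectors `v`. Its product is the geometric product. -/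
abbrev GeomTangent (x : M) : Type _ := CliffordAlgebra (g.quadraticForm x)

/-- Tangent vectors as tangent multivectors (the grade-one part of the algebra). -/
abbrev vec (x : M) : TangentSpace (𝓡 n) x →ₗ[ℝ] g.GeomTangent x :=
  CliffordAlgebra.ι (g.quadraticForm x)

/-- The wedge product `v 0 ∧ ⋯ ∧ v (k - 1)` of tangent vectors, as a multivector. -/
def wedge (x : M) {k : ℕ} (v : Fin k → TangentSpace (𝓡 n) x) : g.GeomTangent x :=
  (CliffordAlgebra.equivExterior (g.quadraticForm x)).symm (ExteriorAlgebra.ιMulti ℝ k v)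

/-- The coordinate multivector frame `E_J = E_{j₀} ∧ ⋯ ∧ E_{jₘ}` (`j₀ < ⋯ < jₘ` the elements of
`J`) built from the coordinate vector fields of the chart at `p`; `E_∅ = 1`. -/
def coordMultivector (p : M) (J : Finset (Fin n)) (x : M) : g.GeomTangent x :=
  g.wedge x fun k ↦ coordVector p (J.orderEmbOfFin rfl k) x

/-- A (locally given) multivector field is smooth in a neighbourhood of `p`: near `p` its
coefficients in the coordinate multivector frame of the chart at `p` are smooth. -/
def SmoothNear (A : (x : M) → g.GeomTangent x) (p : M) : Prop :=
  ∃ W : Set M, IsOpen W ∧ p ∈ W ∧ W ⊆ (chartAt (EuclideanSpace ℝ (Fin n)) p).source ∧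
    ∃ c : Finset (Fin n) → M → ℝ, (∀ J, ContMDiffOn (𝓡 n) 𝓘(ℝ, ℝ) ∞ (c J) W) ∧
      ∀ x ∈ W, A x = ∑ J, c J x • g.coordMultivector p J x

/-- The metric coefficients `g_ij = e_i · e_j` of a frame. -/
def coeff (e : Fin n → (x : M) → TangentSpace (𝓡 n) x) (i j : Fin n) (x : M) : ℝ :=
  g.inner x (e i x) (e j x)

/-- The reciprocal frame `e^k = g^{kl} e_l`, so that `e^k · e_j = δ^k_j`. -/
def reciprocal (e : Fin n → (x : M) → TangentSpace (𝓡 n) x) (k : Fin n) (x : M) :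
    TangentSpace (𝓡 n) x :=
  ∑ l, (Matrix.of fun i j ↦ g.coeff e i j x)⁻¹ k l • e l x

/-- The commutator coefficients `L_ijk = [e_i, e_j] · e_k`, i.e. `[e_i, e_j] = L_ijk e^k`. -/
def bracketCoeff (e : Fin n → (x : M) → TangentSpace (𝓡 n) x) (i j k : Fin n) (x : M) : ℝ :=
  g.inner x (VectorField.mlieBracket (𝓡 n) (e i) (e j) x) (e k x)

/-- `∂_{e_i} g_jk`. -/
def derivCoeff (e : Fin n → (x : M) → TangentSpace (𝓡 n) x) (i j k : Fin n) (x : M) : ℝ :=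
  mvfderiv (𝓡 n) (g.coeff e j k) x (e i x)

/-- The standard (Levi-Civita) coefficients of a frame. -/
def leviCivitaCoeff (e : Fin n → (x : M) → TangentSpace (𝓡 n) x) (i j k : Fin n) (x : M) : ℝ :=
  (1 / 2) * (g.derivCoeff e i j k x - g.derivCoeff e k i j x + g.derivCoeff e j k i x) +
  (1 / 2) * (g.bracketCoeff e i j k x - g.bracketCoeff e j k i x + g.bracketCoeff e k i j x)

end PseudoRiemannianMetric

/-- A multivector directional derivative on the open set `U`: for every `p ∈ U` an operator taking
a tangent vector `a` at `p` and a multivector field `A` that is smooth near `p` to a tangent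
multivector `D_a A` at `p`. Local fields are represented by functions on all of `M`; the last field
only normalizes the value of the operator outside its domain, so that two multivector directional
derivatives are equal exactly if they agree on all fields that are smooth near the point. -/
@[ext]
structure MDD {n : ℕ} {M : Type*} [TopologicalSpace M]
    [ChartedSpace (EuclideanSpace ℝ (Fin n)) M] [IsManifold (𝓡 n) ∞ M]
    (g : PseudoRiemannianMetric n M) (U : TopologicalSpace.Opens M) where
  toFun (p : U) (a : TangentSpace (𝓡 n) (p : M)) (A : (x : M) → g.GeomTangent x) :
    g.GeomTangent (p : M)
  /-- Linearity in the direction argument. -/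
  linear_direction (p : U) (α β : ℝ) (a b : TangentSpace (𝓡 n) (p : M))
    (A : (x : M) → g.GeomTangent x) (hA : g.SmoothNear A p) :
    toFun p (α • a + β • b) A = α • toFun p a A + β • toFun p b A
  /-- On scalar fields, `D` is the scalar-field directional derivative. -/
  scalar (p : U) (a : TangentSpace (𝓡 n) (p : M)) (φ : M → ℝ)
    (hφ : ScalarSmoothNear (n := n) φ p) :
    toFun p a (fun x ↦ algebraMap ℝ (g.GeomTangent x) (φ x)) =
      algebraMap ℝ (g.GeomTangent (p : M)) (mvfderiv (𝓡 n) φ (p : M) a)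
  /-- The derivative of a vector field is a vector. -/
  vector (p : U) (a : TangentSpace (𝓡 n) (p : M)) (v : (x : M) → TangentSpace (𝓡 n) x)
    (hv : VectorSmoothNear v (p : M)) :
    toFun p a (fun x ↦ g.vec x (v x)) ∈ LinearMap.range (g.vec (p : M))
  /-- Additivity in the field argument. -/
  add (p : U) (a : TangentSpace (𝓡 n) (p : M)) (A B : (x : M) → g.GeomTangent x)
    (hA : g.SmoothNear A p) (hB : g.SmoothNear B p) :
    toFun p a (fun x ↦ A x + B x) = toFun p a A + toFun p a B
  /-- Product rule for the geometric product. -/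
  mul (p : U) (a : TangentSpace (𝓡 n) (p : M)) (A B : (x : M) → g.GeomTangent x)
    (hA : g.SmoothNear A p) (hB : g.SmoothNear B p) :
    toFun p a (fun x ↦ A x * B x) = toFun p a A * B p + A p * toFun p a B
  /-- Normalization outside the domain of the operator. -/
  outside (p : U) (a : TangentSpace (𝓡 n) (p : M)) (A : (x : M) → g.GeomTangent x)
    (hA : ¬ g.SmoothNear A p) : toFun p a A = 0

namespace MDD

variable {n : ℕ} {M : Type*} [TopologicalSpace M]
  [ChartedSpace (EuclideanSpace ℝ (Fin n)) M] [IsManifold (𝓡 n) ∞ M]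
  {g : PseudoRiemannianMetric n M} {U : TopologicalSpace.Opens M}

/-- The restriction of a multivector directional derivative to a smaller open set. -/
def restrict (D : MDD g U) {V : TopologicalSpace.Opens M} (hV : V ≤ U) : MDD g V where
  toFun p := D.toFun ⟨p, hV p.2⟩
  linear_direction p := D.linear_direction ⟨p, hV p.2⟩
  scalar p := D.scalar ⟨p, hV p.2⟩
  vector p := D.vector ⟨p, hV p.2⟩
  add p := D.add ⟨p, hV p.2⟩
  mul p := D.mul ⟨p, hV p.2⟩
  outside p := D.outside ⟨p, hV p.2⟩

/-- `D` sends smooth fields to smooth fields: if the vector field `a` and the multivector field `A`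
are smooth near a point of `U`, then so is the multivector field `D_a A`. -/
def PreservesSmoothness (D : MDD g U) : Prop :=
  ∀ (p : U) (a : (x : M) → TangentSpace (𝓡 n) x) (A : (x : M) → g.GeomTangent x),
    VectorSmoothNear a (p : M) → g.SmoothNear A p →
      ∃ B : (x : M) → g.GeomTangent x, g.SmoothNear B p ∧ ∀ q : U, B q = D.toFun q (a q) A

/-- The torsion `D_a b - D_b a - [a, b]` vanishes for all smooth vector fields `a`, `b`. -/
def IsTorsionFree (D : MDD g U) : Prop :=
  ∀ (p : U) (a b : (x : M) → TangentSpace (𝓡 n) x),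
    VectorSmoothNear a (p : M) → VectorSmoothNear b (p : M) →
      D.toFun p (a p) (fun x ↦ g.vec x (b x)) - D.toFun p (b p) (fun x ↦ g.vec x (a x)) -
        g.vec (p : M) (VectorField.mlieBracket (𝓡 n) a b (p : M)) = 0

/-- `Γ_ijk` are the connection coefficients of `D` in the frame `e` on `U`:
`D_{e_i} e_j = Γ_ijk e^k` at every point of `U`. -/
def HasConnectionCoeffs (D : MDD g U) (e : Fin n → (x : M) → TangentSpace (𝓡 n) x)
    (Γ : Fin n → Fin n → Fin n → U → ℝ) : Prop :=
  ∀ (p : U) (i j : Fin n), D.toFun p (e i p) (fun x ↦ g.vec x (e j x)) =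
    ∑ k, Γ i j k p • g.vec (p : M) (g.reciprocal e k p)

/-- `χ_ijk` are the contorsion coefficients of `D` in the frame `e` on `U`: the connection
coefficients of `D` are the standard coefficients plus `χ_ijk`. -/
def HasContorsionCoeffs (D : MDD g U) (e : Fin n → (x : M) → TangentSpace (𝓡 n) x)
    (χ : Fin n → Fin n → Fin n → U → ℝ) : Prop :=
  D.HasConnectionCoeffs e fun i j k p ↦ g.leviCivitaCoeff e i j k p + χ i j k p

end MDD

end

/-! The axioms of an MDD at different points of `U` do not interact, so everything is first decided
at a single point `p` (`IsDerivativeAt`) and then assembled pointwise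
(`exists_eq_of_isDerivativeAt`), even with a different frame at each point.

Uniqueness at `p`: scalar fields and vector fields generate all smooth multivector fields, because
`v ∧ A = vA - v ⌟ A` turns wedges into geometric products (`SmoothNear.induction`). By the product
rule a derivative is determined by its values on a frame, that is, by its connection coefficients.
Differentiating `vw + wv = 2 v · w` gives metric compatibility (`mvfderiv_inner`), which is the only
constraint on them.

Existence at `p` has two steps. A matrix square root gives isometries from nearby tangent spaces to
the one at `p`, differentiable at `p`; they extend to algebra homomorphisms `Φ x` of the geometric
algebras, and differentiating `Φ x (A x)` at `p` gives one derivative (`exists_isDerivativeAt`). Two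
metric-compatible families of coefficients differ by a skew endomorphism depending linearly on the
direction. Every such endomorphism is the commutator with a multivector, and adding this inner
derivation realizes every admissible family (`exists_nabla_eq_add`).

Torsion is tensorial, so it may be tested on a frame. There a family is fixed by its part symmetric
in the last two indices (the metric) and its part antisymmetric in the first two (the torsion),
which singles out the Levi-Civita coefficients (`torsion_eq_zero_iff`). The torsion-free MDD is
built at each point from the coordinate frame there; since vanishing torsion does not refer to a
frame, its coefficients are the Levi-Civita ones in every frame, and smoothness follows. -/

open Filter Topology Bundle

/-! ### Smooth scalar and vector fields -/

section SmoothFields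

variable {n : ℕ} {M : Type*} [TopologicalSpace M]
  [ChartedSpace (EuclideanSpace ℝ (Fin n)) M]

theorem scalarSmoothNear_iff {φ : M → ℝ} {p : M} :
    ScalarSmoothNear (n := n) φ p ↔ ∀ᶠ q in 𝓝 p, ContMDiffAt (𝓡 n) 𝓘(ℝ, ℝ) ∞ φ q := by
  constructor
  · rintro ⟨W, hW, hp, h⟩
    filter_upwards [hW.mem_nhds hp] with q hq using h.contMDiffAt (hW.mem_nhds hq)
  · intro h
    obtain ⟨W, h1, h2, h3⟩ := eventually_nhds_iff.1 h
    exact ⟨W, h2, h3, fun x hx ↦ (h1 x hx).contMDiffWithinAt⟩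

namespace ScalarSmoothNear

variable {φ ψ : M → ℝ} {p : M}

theorem contMDiffAt (h : ScalarSmoothNear (n := n) φ p) :
    ContMDiffAt (𝓡 n) 𝓘(ℝ, ℝ) ∞ φ p :=
  (scalarSmoothNear_iff.1 h).self_of_nhds

theorem mdifferentiableAt (h : ScalarSmoothNear (n := n) φ p) :
    MDifferentiableAt (𝓡 n) 𝓘(ℝ, ℝ) φ p :=
  h.contMDiffAt.mdifferentiableAt (by simp)

theorem eventually (h : ScalarSmoothNear (n := n) φ p) :
    ∀ᶠ q in 𝓝 p, ScalarSmoothNear (n := n) φ q := by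
  simp_rw [scalarSmoothNear_iff] at h ⊢
  exact h.eventually_nhds

theorem congr (h : ScalarSmoothNear (n := n) φ p) (e : ψ =ᶠ[𝓝 p] φ) :
    ScalarSmoothNear (n := n) ψ p := by
  rw [scalarSmoothNear_iff] at h ⊢
  filter_upwards [h, e.eventually_nhds] with q h1 h2 using h1.congr_of_eventuallyEq h2

theorem const (c : ℝ) : ScalarSmoothNear (n := n) (fun _ : M ↦ c) p :=
  scalarSmoothNear_iff.2 (.of_forall fun _ ↦ contMDiffAt_const)

theorem add (h : ScalarSmoothNear (n := n) φ p) (h' : ScalarSmoothNear (n := n) ψ p) :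
    ScalarSmoothNear (n := n) (fun x ↦ φ x + ψ x) p := by
  rw [scalarSmoothNear_iff] at h h' ⊢
  filter_upwards [h, h'] with q h1 h2 using h1.add h2

theorem mul (h : ScalarSmoothNear (n := n) φ p) (h' : ScalarSmoothNear (n := n) ψ p) :
    ScalarSmoothNear (n := n) (fun x ↦ φ x * ψ x) p := by
  rw [scalarSmoothNear_iff] at h h' ⊢
  filter_upwards [h, h'] with q h1 h2 using h1.mul h2

theorem neg (h : ScalarSmoothNear (n := n) φ p) :
    ScalarSmoothNear (n := n) (fun x ↦ -φ x) p := by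
  simpa using (const (-1)).mul h

theorem sub (h : ScalarSmoothNear (n := n) φ p) (h' : ScalarSmoothNear (n := n) ψ p) :
    ScalarSmoothNear (n := n) (fun x ↦ φ x - ψ x) p := by
  simpa [sub_eq_add_neg] using h.add h'.neg

theorem sum {ι : Type*} {s : Finset ι} {f : ι → M → ℝ}
    (h : ∀ i ∈ s, ScalarSmoothNear (n := n) (f i) p) :
    ScalarSmoothNear (n := n) (fun x ↦ ∑ i ∈ s, f i x) p := by
  classical
  induction s using Finset.induction_on with
  | empty => simpa using const 0
  | insert a s ha ih =>
    simp only [Finset.sum_insert ha]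
    exact (h a (by simp)).add (ih fun i hi ↦ h i (by simp [hi]))

theorem prod {ι : Type*} {s : Finset ι} {f : ι → M → ℝ}
    (h : ∀ i ∈ s, ScalarSmoothNear (n := n) (f i) p) :
    ScalarSmoothNear (n := n) (fun x ↦ ∏ i ∈ s, f i x) p := by
  classical
  induction s using Finset.induction_on with
  | empty => simpa using const 1
  | insert a s ha ih =>
    simp only [Finset.prod_insert ha]
    exact (h a (by simp)).mul (ih fun i hi ↦ h i (by simp [hi]))

theorem inv (h : ScalarSmoothNear (n := n) φ p) (h0 : φ p ≠ 0) :
    ScalarSmoothNear (n := n) (fun x ↦ (φ x)⁻¹) p := by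
  have h1 := h.contMDiffAt.continuousAt.eventually_ne h0
  rw [scalarSmoothNear_iff] at h ⊢
  filter_upwards [h, h1] with q h1 h2
  exact ((contDiffAt_inv ℝ h2).contMDiffAt).comp q h1

theorem det {m : ℕ} {A : Fin m → Fin m → M → ℝ}
    (h : ∀ i j, ScalarSmoothNear (n := n) (A i j) p) :
    ScalarSmoothNear (n := n) (fun x ↦ (Matrix.of fun i j ↦ A i j x).det) p := by
  simp_rw [Matrix.det_apply']
  exact sum fun σ _ ↦ (const _).mul (prod fun i _ ↦ h _ _)

theorem matrix_inv {m : ℕ} {A : Fin m → Fin m → M → ℝ}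
    (h : ∀ i j, ScalarSmoothNear (n := n) (A i j) p)
    (h0 : (Matrix.of fun i j ↦ A i j p).det ≠ 0) (i j : Fin m) :
    ScalarSmoothNear (n := n) (fun x ↦ (Matrix.of fun i j ↦ A i j x)⁻¹ i j) p := by
  simp only [Matrix.inv_def, Ring.inverse_eq_inv', Matrix.smul_apply, smul_eq_mul,
    Matrix.adjugate_apply]
  refine ((det h).inv h0).mul ?_
  -- Cramer's rule: entry `(i, j)` of the adjugate is the determinant after row `j` is replaced by
  -- the `i`-th unit row.
  have := det (A := fun k l x ↦ if k = j then (if l = i then 1 else 0) else A k l x) (n := n)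
    (p := p) ?_
  · convert this using 3 with x
    ext k l
    by_cases hk : k = j
    · subst hk
      simp [Pi.single_apply]
    · simp [hk]
  · intro k l
    split_ifs
    exacts [const _, const _, h _ _]

end ScalarSmoothNear

variable [IsManifold (𝓡 n) ∞ M]

theorem vectorSmoothNear_iff {v : (x : M) → TangentSpace (𝓡 n) x} {p : M} :
    VectorSmoothNear v p ↔ ∀ᶠ q in 𝓝 p, ContMDiffAt (𝓡 n) (𝓡 n).tangent ∞
      (fun x ↦ (⟨x, v x⟩ : TangentBundle (𝓡 n) M)) q := by
  constructor
  · rintro ⟨W, hW, hp, h⟩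
    filter_upwards [hW.mem_nhds hp] with q hq using h.contMDiffAt (hW.mem_nhds hq)
  · intro h
    obtain ⟨W, h1, h2, h3⟩ := eventually_nhds_iff.1 h
    exact ⟨W, h2, h3, fun x hx ↦ (h1 x hx).contMDiffWithinAt⟩

namespace VectorSmoothNear

variable {φ : M → ℝ} {v w : (x : M) → TangentSpace (𝓡 n) x} {p : M}

theorem contMDiffAt (h : VectorSmoothNear v p) :
    ContMDiffAt (𝓡 n) (𝓡 n).tangent ∞ (fun x ↦ (⟨x, v x⟩ : TangentBundle (𝓡 n) M)) p :=
  (vectorSmoothNear_iff.1 h).self_of_nhds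

theorem mdifferentiableAt (h : VectorSmoothNear v p) :
    MDifferentiableAt (𝓡 n) (𝓡 n).tangent (fun x ↦ (⟨x, v x⟩ : TangentBundle (𝓡 n) M)) p :=
  h.contMDiffAt.mdifferentiableAt (by simp)

theorem eventually (h : VectorSmoothNear v p) : ∀ᶠ q in 𝓝 p, VectorSmoothNear v q := by
  simp_rw [vectorSmoothNear_iff] at h ⊢
  exact h.eventually_nhds

theorem congr (h : VectorSmoothNear v p) (e : ∀ᶠ x in 𝓝 p, w x = v x) :
    VectorSmoothNear w p := by
  rw [vectorSmoothNear_iff] at h ⊢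
  filter_upwards [h, e.eventually_nhds] with q h1 h2
  refine h1.congr_of_eventuallyEq ?_
  filter_upwards [h2] with x hx
  rw [hx]

theorem add (h : VectorSmoothNear v p) (h' : VectorSmoothNear w p) :
    VectorSmoothNear (fun x ↦ v x + w x) p := by
  rw [vectorSmoothNear_iff] at h h' ⊢
  filter_upwards [h, h'] with q h1 h2 using h1.add_section h2

theorem smul (h : ScalarSmoothNear (n := n) φ p) (h' : VectorSmoothNear v p) :
    VectorSmoothNear (fun x ↦ φ x • v x) p := by
  rw [scalarSmoothNear_iff] at h
  rw [vectorSmoothNear_iff] at h' ⊢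
  filter_upwards [h, h'] with q h1 h2 using h1.smul_section h2

theorem sum {ι : Type*} {s : Finset ι} {f : ι → (x : M) → TangentSpace (𝓡 n) x}
    (h : ∀ i ∈ s, VectorSmoothNear (f i) p) :
    VectorSmoothNear (fun x ↦ ∑ i ∈ s, f i x) p := by
  have : ∀ᶠ q in 𝓝 p, ∀ i ∈ s, ContMDiffAt (𝓡 n) (𝓡 n).tangent ∞
      (fun x ↦ (⟨x, f i x⟩ : TangentBundle (𝓡 n) M)) q :=
    (Filter.eventually_all_finset s).2 fun i hi ↦ vectorSmoothNear_iff.1 (h i hi)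
  rw [vectorSmoothNear_iff]
  filter_upwards [this] with q h1 using ContMDiffAt.sum_section h1

theorem mlieBracket (h : VectorSmoothNear v p) (h' : VectorSmoothNear w p) :
    VectorSmoothNear (VectorField.mlieBracket (𝓡 n) v w) p := by
  rw [vectorSmoothNear_iff] at h h' ⊢
  have : IsManifold (𝓡 n) (((⊤ : ℕ∞) : WithTop ℕ∞) + 1) M := by simpa
  have : IsManifold (𝓡 n) (minSmoothness ℝ 2) M := by
    rw [minSmoothness_of_isRCLikeNormedField]; infer_instance
  filter_upwards [h, h'] with q h1 h2
  exact ContMDiffAt.mlieBracket_vectorField (m := ⊤) (n := ⊤) h1 h2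
    (by rw [minSmoothness_of_isRCLikeNormedField]; simp)

/-- The derivative along `v` is the fibre component of the tangent map of `φ` composed with the
section `v`; on an open set the derivative within the set is the full one. -/
theorem mvfderiv (h : ScalarSmoothNear (n := n) φ p) (h' : VectorSmoothNear v p) :
    ScalarSmoothNear (n := n) (fun x ↦ mvfderiv (𝓡 n) φ x (v x)) p := by
  obtain ⟨W, hW, hpW, hφ⟩ := h
  obtain ⟨W', hW', hpW', hv⟩ := h'
  have hO : IsOpen (W ∩ W') := hW.inter hW'
  refine ⟨W ∩ W', hO, ⟨hpW, hpW'⟩, ?_⟩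
  have h1 := (hφ.mono (Set.inter_subset_left (t := W'))).contMDiffOn_tangentMapWithin
    (m := ∞) (by simp) hO.uniqueMDiffOn
  have h2 := h1.comp (hv.mono (Set.inter_subset_right (s := W))) (fun x hx ↦ hx)
  have h3 := (contMDiff_snd_tangentBundle_modelSpace ℝ 𝓘(ℝ, ℝ) (n := ∞)).comp_contMDiffOn h2
  refine h3.congr fun x hx ↦ ?_
  change mfderiv (𝓡 n) 𝓘(ℝ, ℝ) φ x (v x) = mfderivWithin (𝓡 n) 𝓘(ℝ, ℝ) φ (W ∩ W') x (v x)
  rw [mfderivWithin_of_isOpen hO hx]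

end VectorSmoothNear

theorem IsLocalFrameOn.vectorSmoothNear {e : Fin n → (x : M) → TangentSpace (𝓡 n) x} {V : Set M}
    (he : IsLocalFrameOn (𝓡 n) (EuclideanSpace ℝ (Fin n)) ∞ e V) (hV : IsOpen V) {p : M}
    (hp : p ∈ V) (i : Fin n) : VectorSmoothNear (e i) p :=
  ⟨V, hV, hp, he.contMDiffOn i⟩

/-- The coordinate vector fields of a chart form a smooth frame on the chart domain. -/
theorem isLocalFrameOn_coordVector (p : M) :
    IsLocalFrameOn (𝓡 n) (EuclideanSpace ℝ (Fin n)) ∞ (coordVector (n := n) p)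
      (chartAt (EuclideanSpace ℝ (Fin n)) p).source := by
  set t := trivializationAt (EuclideanSpace ℝ (Fin n)) (TangentSpace (𝓡 n) : M → Type _) p
  refine IsLocalFrameOn.congr (t.isLocalFrameOn_localFrame_baseSet (𝓡 n) ∞
    (EuclideanSpace.basisFun (Fin n) ℝ).toBasis) ?_
  intro i x hx
  have hx' : x ∈ t.baseSet := hx
  rw [Trivialization.localFrame_apply_of_mem_baseSet _ _ hx', coordVector,
    ← mfderivWithin_univ, ← (𝓡 n).range_eq_univ,
    ← TangentBundle.symmL_trivializationAt (I := 𝓡 n) hx]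
  simp only [Trivialization.basisAt, t, Module.Basis.map_apply, OrthonormalBasis.coe_toBasis,
    EuclideanSpace.basisFun_apply]
  exact (Trivialization.symmL_apply (R := ℝ) _ hx' _).symm

end SmoothFields

/-! ### Frames, reciprocal frames and the Levi-Civita coefficients -/

namespace PseudoRiemannianMetric

variable {n : ℕ} {M : Type*} [TopologicalSpace M]
  [ChartedSpace (EuclideanSpace ℝ (Fin n)) M] [IsManifold (𝓡 n) ∞ M]
  (g : PseudoRiemannianMetric n M) {p : M}

theorem scalarSmoothNear_inner {v w : (x : M) → TangentSpace (𝓡 n) x}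
    (hv : VectorSmoothNear v p) (hw : VectorSmoothNear w p) :
    ScalarSmoothNear (n := n) (fun x ↦ g.inner x (v x) (w x)) p := by
  rw [vectorSmoothNear_iff] at hv hw
  rw [scalarSmoothNear_iff]
  filter_upwards [hv, hw] with q h1 h2
  have := ContMDiffAt.clm_bundle_apply₂ (F₁ := EuclideanSpace ℝ (Fin n))
    (F₂ := EuclideanSpace ℝ (Fin n)) (F₃ := ℝ)
    (E₁ := fun x : M ↦ TangentSpace (𝓡 n) x)
    (E₂ := fun x : M ↦ TangentSpace (𝓡 n) x) (E₃ := Bundle.Trivial M ℝ) (b := fun x ↦ x)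
    (g.contMDiff q) h1 h2
  rw [Bundle.contMDiffAt_section] at this
  exact this

variable {e : Fin n → (x : M) → TangentSpace (𝓡 n) x} {V : Set M}

theorem eq_zero_of_inner_frame_eq_zero
    (he : IsLocalFrameOn (𝓡 n) (EuclideanSpace ℝ (Fin n)) ∞ e V) {x : M} (hx : x ∈ V)
    {v : TangentSpace (𝓡 n) x} (h : ∀ i, g.inner x v (e i x) = 0) : v = 0 := by
  refine g.nondegenerate x v fun w ↦ ?_
  have hw : w ∈ Submodule.span ℝ (Set.range (e · x)) := he.generating hx trivial
  induction hw using Submodule.span_induction with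
  | mem w hw => obtain ⟨i, rfl⟩ := hw; exact h i
  | zero => exact map_zero _
  | add a b _ _ ha hb => rw [map_add, ha, hb, add_zero]
  | smul c a _ ha => rw [map_smul, ha, smul_zero]

/-- A kernel vector of the Gram matrix would give a combination of the frame orthogonal to the whole
frame, which nondegeneracy and linear independence exclude. Definiteness plays no role. -/
theorem coeff_det_ne_zero (he : IsLocalFrameOn (𝓡 n) (EuclideanSpace ℝ (Fin n)) ∞ e V)
    {x : M} (hx : x ∈ V) : (Matrix.of fun i j ↦ g.coeff e i j x).det ≠ 0 := by
  intro h
  obtain ⟨c, hc, h⟩ := Matrix.exists_mulVec_eq_zero_iff.2 h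
  have h1 : ∑ j, c j • e j x = 0 := by
    refine g.eq_zero_of_inner_frame_eq_zero he hx fun i ↦ ?_
    have := congrFun h i
    rw [g.symm]
    simpa [Matrix.mulVec, dotProduct, coeff, mul_comm] using this
  exact hc (funext (Fintype.linearIndependent_iff.1 (he.linearIndependent hx) c h1))

theorem inner_reciprocal (he : IsLocalFrameOn (𝓡 n) (EuclideanSpace ℝ (Fin n)) ∞ e V)
    {x : M} (hx : x ∈ V) (k j : Fin n) :
    g.inner x (g.reciprocal e k x) (e j x) = if k = j then 1 else 0 := by
  have h := Matrix.nonsing_inv_mul _ (g.coeff_det_ne_zero he hx).isUnit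
  have := congrFun (congrFun h k) j
  rw [Matrix.mul_apply, Matrix.one_apply] at this
  rw [← this, reciprocal]
  simp [coeff]

theorem eq_sum_reciprocal (he : IsLocalFrameOn (𝓡 n) (EuclideanSpace ℝ (Fin n)) ∞ e V)
    {x : M} (hx : x ∈ V) (v : TangentSpace (𝓡 n) x) :
    v = ∑ k, g.inner x v (e k x) • g.reciprocal e k x := by
  rw [← sub_eq_zero]
  refine g.eq_zero_of_inner_frame_eq_zero he hx fun i ↦ ?_
  simp [g.inner_reciprocal he hx]

theorem scalarSmoothNear_coeff (he : IsLocalFrameOn (𝓡 n) (EuclideanSpace ℝ (Fin n)) ∞ e V)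
    (hV : IsOpen V) (hp : p ∈ V) (i j : Fin n) :
    ScalarSmoothNear (n := n) (g.coeff e i j) p :=
  g.scalarSmoothNear_inner (he.vectorSmoothNear hV hp i) (he.vectorSmoothNear hV hp j)

theorem vectorSmoothNear_reciprocal
    (he : IsLocalFrameOn (𝓡 n) (EuclideanSpace ℝ (Fin n)) ∞ e V)
    (hV : IsOpen V) (hp : p ∈ V) (k : Fin n) : VectorSmoothNear (g.reciprocal e k) p :=
  .sum fun l _ ↦ .smul (.matrix_inv (fun i j ↦ g.scalarSmoothNear_coeff he hV hp i j)
    (g.coeff_det_ne_zero he hp) k l) (he.vectorSmoothNear hV hp l)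

/-- A smooth vector field has smooth components in every smooth frame. -/
theorem exists_frame_components (g : PseudoRiemannianMetric n M)
    (he : IsLocalFrameOn (𝓡 n) (EuclideanSpace ℝ (Fin n)) ∞ e V)
    (hV : IsOpen V) (hp : p ∈ V) {v : (x : M) → TangentSpace (𝓡 n) x}
    (hv : VectorSmoothNear v p) :
    ∃ c : Fin n → M → ℝ, (∀ i, ScalarSmoothNear (n := n) (c i) p) ∧
      ∀ᶠ x in 𝓝 p, v x = ∑ i, c i x • e i x := by
  refine ⟨fun l x ↦ ∑ k, g.inner x (v x) (e k x) *
    (Matrix.of fun i j ↦ g.coeff e i j x)⁻¹ k l, fun l ↦ .sum fun k _ ↦ .mul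
      (g.scalarSmoothNear_inner hv (he.vectorSmoothNear hV hp k))
      (.matrix_inv (fun i j ↦ g.scalarSmoothNear_coeff he hV hp i j)
        (g.coeff_det_ne_zero he hp) k l), ?_⟩
  filter_upwards [hV.mem_nhds hp] with x hx
  conv_lhs => rw [g.eq_sum_reciprocal he hx (v x)]
  simp only [reciprocal, Finset.smul_sum, Finset.sum_smul, smul_smul]
  exact Finset.sum_comm

theorem scalarSmoothNear_derivCoeff
    (he : IsLocalFrameOn (𝓡 n) (EuclideanSpace ℝ (Fin n)) ∞ e V)
    (hV : IsOpen V) (hp : p ∈ V) (i j k : Fin n) :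
    ScalarSmoothNear (n := n) (g.derivCoeff e i j k) p :=
  VectorSmoothNear.mvfderiv (g.scalarSmoothNear_coeff he hV hp j k) (he.vectorSmoothNear hV hp i)

theorem scalarSmoothNear_bracketCoeff
    (he : IsLocalFrameOn (𝓡 n) (EuclideanSpace ℝ (Fin n)) ∞ e V)
    (hV : IsOpen V) (hp : p ∈ V) (i j k : Fin n) :
    ScalarSmoothNear (n := n) (g.bracketCoeff e i j k) p :=
  g.scalarSmoothNear_inner (.mlieBracket (he.vectorSmoothNear hV hp i)
    (he.vectorSmoothNear hV hp j)) (he.vectorSmoothNear hV hp k)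

theorem scalarSmoothNear_leviCivitaCoeff
    (he : IsLocalFrameOn (𝓡 n) (EuclideanSpace ℝ (Fin n)) ∞ e V)
    (hV : IsOpen V) (hp : p ∈ V) (i j k : Fin n) :
    ScalarSmoothNear (n := n) (g.leviCivitaCoeff e i j k) p := by
  have hd := g.scalarSmoothNear_derivCoeff he hV hp
  have hb := g.scalarSmoothNear_bracketCoeff he hV hp
  exact (((ScalarSmoothNear.const _).mul (((hd _ _ _).sub (hd _ _ _)).add (hd _ _ _))).add
    ((ScalarSmoothNear.const _).mul (((hb _ _ _).sub (hb _ _ _)).add (hb _ _ _))))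

theorem coeff_comm (e : Fin n → (x : M) → TangentSpace (𝓡 n) x) (i j : Fin n) :
    g.coeff e i j = g.coeff e j i :=
  funext fun x ↦ g.symm x _ _

theorem derivCoeff_comm (e : Fin n → (x : M) → TangentSpace (𝓡 n) x) (i j k : Fin n) (x : M) :
    g.derivCoeff e i j k x = g.derivCoeff e i k j x := by
  rw [derivCoeff, derivCoeff, g.coeff_comm]

theorem bracketCoeff_swap (e : Fin n → (x : M) → TangentSpace (𝓡 n) x) (i j k : Fin n) (x : M) :
    g.bracketCoeff e i j k x = -g.bracketCoeff e j i k x := by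
  rw [bracketCoeff, bracketCoeff, VectorField.mlieBracket_swap_apply, map_neg]
  rfl

/-- The bracket half is antisymmetric in `j, k`, and of the metric half only the term `∂_i g_jk`
survives symmetrization. -/
theorem leviCivitaCoeff_add_swap (e : Fin n → (x : M) → TangentSpace (𝓡 n) x) (i j k : Fin n)
    (x : M) : g.leviCivitaCoeff e i j k x + g.leviCivitaCoeff e i k j x =
      g.derivCoeff e i j k x := by
  simp only [leviCivitaCoeff]
  rw [g.derivCoeff_comm e k j i, g.derivCoeff_comm e i k j, g.derivCoeff_comm e j i k,
    g.bracketCoeff_swap e k j i, g.bracketCoeff_swap e k i j, g.bracketCoeff_swap e j i k]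
  ring

/-- Here the metric half is symmetric in `i, j` and drops out. Together with the preceding identity
this characterizes the coefficients. -/
theorem leviCivitaCoeff_sub_swap (e : Fin n → (x : M) → TangentSpace (𝓡 n) x) (i j k : Fin n)
    (x : M) : g.leviCivitaCoeff e i j k x - g.leviCivitaCoeff e j i k x =
      g.bracketCoeff e i j k x := by
  simp only [leviCivitaCoeff]
  rw [g.derivCoeff_comm e j k i, g.derivCoeff_comm e k j i, g.derivCoeff_comm e i k j,
    g.bracketCoeff_swap e k j i, g.bracketCoeff_swap e i k j, g.bracketCoeff_swap e j i k]
  ring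

end PseudoRiemannianMetric

/-! ### The geometric algebra of one tangent space -/

namespace PseudoRiemannianMetric

section Pointwise

variable {n : ℕ} {M : Type*} [TopologicalSpace M]
  [ChartedSpace (EuclideanSpace ℝ (Fin n)) M] [IsManifold (𝓡 n) ∞ M]
  (g : PseudoRiemannianMetric n M) (x : M)

theorem quadraticForm_apply (v : TangentSpace (𝓡 n) x) : g.quadraticForm x v = g.inner x v v :=
  rfl

theorem vec_mul_vec_add_swap (v w : TangentSpace (𝓡 n) x) :
    g.vec x v * g.vec x w + g.vec x w * g.vec x v = algebraMap ℝ _ (2 * g.inner x v w) := by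
  rw [CliffordAlgebra.ι_mul_ι_add_swap]
  congr 1
  simp only [QuadraticMap.polar, quadraticForm_apply, map_add, add_apply]
  rw [g.symm x w v]
  ring

theorem vec_injective : Function.Injective (g.vec x) := by
  intro v w h
  have := congrArg (CliffordAlgebra.equivExterior (g.quadraticForm x)) h
  simpa [vec, CliffordAlgebra.equivExterior, CliffordAlgebra.changeFormEquiv] using this

/-- Contraction of a multivector with a tangent vector from the left. -/
noncomputable def contract : TangentSpace (𝓡 n) x →ₗ[ℝ] g.GeomTangent x →ₗ[ℝ] g.GeomTangent x :=
  CliffordAlgebra.contractLeft.comp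
    (ContinuousLinearMap.coeLM ℝ ∘ₗ (g.inner x : TangentSpace (𝓡 n) x →ₗ[ℝ] _))

theorem contract_algebraMap (v : TangentSpace (𝓡 n) x) (r : ℝ) :
    g.contract x v (algebraMap ℝ _ r) = 0 :=
  CliffordAlgebra.contractLeft_algebraMap _ _ _

theorem contract_vec_mul (v w : TangentSpace (𝓡 n) x) (A : g.GeomTangent x) :
    g.contract x v (g.vec x w * A) = g.inner x v w • A - g.vec x w * g.contract x v A :=
  CliffordAlgebra.contractLeft_ι_mul _ _ _

theorem contract_comm (v w : TangentSpace (𝓡 n) x) (A : g.GeomTangent x) :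
    g.contract x v (g.contract x w A) = -g.contract x w (g.contract x v A) :=
  CliffordAlgebra.contractLeft_comm _ _ _

/-- The exterior product of a tangent vector with a multivector. -/
noncomputable def vecWedge : TangentSpace (𝓡 n) x →ₗ[ℝ] g.GeomTangent x →ₗ[ℝ] g.GeomTangent x :=
  LinearMap.mul ℝ (g.GeomTangent x) ∘ₗ g.vec x - g.contract x

theorem vecWedge_apply (v : TangentSpace (𝓡 n) x) (A : g.GeomTangent x) :
    g.vecWedge x v A = g.vec x v * A - g.contract x v A :=
  rfl

/-- Contraction is an antiderivation of the exterior product too, because contractions anticommute.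
This allows induction on the length of a wedge. -/
theorem contract_vecWedge (v w : TangentSpace (𝓡 n) x) (A : g.GeomTangent x) :
    g.contract x v (g.vecWedge x w A) =
      g.inner x v w • A - g.vecWedge x w (g.contract x v A) := by
  rw [vecWedge_apply, vecWedge_apply, map_sub, contract_vec_mul, contract_comm]
  abel

theorem wedge_zero (v : Fin 0 → TangentSpace (𝓡 n) x) : g.wedge x v = 1 := by
  simp [wedge]

/-- The passage from exterior to geometric algebra changes the quadratic form from zero to the
metric; left multiplication by a vector then acquires a contraction as correction term. -/
theorem wedge_succ {k : ℕ} (v : Fin (k + 1) → TangentSpace (𝓡 n) x) :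
    g.wedge x v = g.vecWedge x (v 0) (g.wedge x fun i ↦ v i.succ) := by
  rw [wedge, ExteriorAlgebra.ιMulti_succ_apply, vecWedge_apply]
  simp only [CliffordAlgebra.equivExterior, CliffordAlgebra.changeFormEquiv_symm]
  refine (CliffordAlgebra.changeForm_ι_mul (CliffordAlgebra.changeForm.neg_proof
    CliffordAlgebra.changeForm.associated_neg_proof) _ _).trans ?_
  -- Inverting the change of form negates its bilinear form; the two signs cancel and leave the
  -- metric.
  have h : (-QuadraticMap.associated (R := ℝ) (-g.quadraticForm x)) (v 0) =
      (g.inner x (v 0) : TangentSpace (𝓡 n) x →ₗ[ℝ] ℝ) := by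
    ext w
    simp [QuadraticMap.associated_apply, quadraticForm_apply, g.symm x w]
    ring
  rw [h]
  rfl

/-- The order of quantifiers matters: `s` depends on `j` alone, so in the coordinate multivector
frame such wedges have constant, hence smooth, coefficients. An injective `j` is sorted by a
permutation; a repeated index gives zero. -/
theorem wedge_comp_eq_sum {k : ℕ} (j : Fin k → Fin n) :
    ∃ s : Finset (Fin n) → ℝ, ∀ (x : M) (E : Fin n → TangentSpace (𝓡 n) x),
      g.wedge x (fun i ↦ E (j i)) =
        ∑ J, s J • g.wedge x fun i ↦ E (Finset.orderEmbOfFin J rfl i) := by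
  by_cases hj : Function.Injective j
  · set J := Finset.univ.image j with hJ
    have hc : J.card = k := by simp [hJ, Finset.card_image_of_injective _ hj]
    let σ : Equiv.Perm (Fin k) := Equiv.ofBijective
      (fun i ↦ (J.orderIsoOfFin hc).symm ⟨j i, by simp [hJ]⟩)
      (Finite.injective_iff_bijective.1 fun a b h ↦ hj (by simpa using h))
    -- The enumeration of `J` depends on a proof of its cardinality; this exchanges `k` for
    -- `J.card`.
    have key : ∀ (m : ℕ) (hm : J.card = m) (x : M) (E : Fin n → TangentSpace (𝓡 n) x),
        g.wedge x (fun i ↦ E (J.orderEmbOfFin hm i)) =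
          g.wedge x fun i ↦ E (J.orderEmbOfFin rfl i) := by
      rintro m rfl x E
      rfl
    refine ⟨Pi.single J (σ.sign : ℤ), fun x E ↦ ?_⟩
    rw [Finset.sum_eq_single J (by simp +contextual) (by simp), ← key k hc]
    have h : (fun i ↦ E (j i)) = (fun i ↦ E (J.orderEmbOfFin hc i)) ∘ σ := by
      funext i
      simp [σ, ← Finset.coe_orderIsoOfFin_apply]
    rw [h, wedge, AlternatingMap.map_perm, Pi.single_eq_same, wedge, Units.smul_def, map_zsmul,
      ← Int.cast_smul_eq_zsmul ℝ]
  · refine ⟨0, fun x E ↦ ?_⟩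
    simp only [Pi.zero_apply, zero_smul, Finset.sum_const_zero]
    rw [wedge, ExteriorAlgebra.ιMulti_eq_zero_of_not_inj, map_zero]
    exact fun h ↦ hj (Function.Injective.of_comp (f := E) h)

/-- The scalar part of a multivector. -/
noncomputable def scalarPart : g.GeomTangent x →ₗ[ℝ] ℝ :=
  (ExteriorAlgebra.algebraMapInv (R := ℝ) (M := TangentSpace (𝓡 n) x)).toLinearMap ∘ₗ
    (CliffordAlgebra.equivExterior (g.quadraticForm x)).toLinearMap

theorem scalarPart_algebraMap (r : ℝ) : g.scalarPart x (algebraMap ℝ _ r) = r := by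
  simp [scalarPart, CliffordAlgebra.changeFormEquiv, ExteriorAlgebra.algebraMapInv]

theorem scalarPart_wedge {k : ℕ} (v : Fin k → TangentSpace (𝓡 n) x) :
    g.scalarPart x (g.wedge x v) = if k = 0 then 1 else 0 := by
  rw [scalarPart, wedge, LinearMap.comp_apply, LinearEquiv.coe_coe, LinearEquiv.apply_symm_apply]
  cases k with
  | zero => simp
  | succ k => simp [ExteriorAlgebra.ιMulti_succ_apply, ExteriorAlgebra.algebraMapInv]

end Pointwise

end PseudoRiemannianMetric

/-! ### Smooth multivector fields and their generation by scalars and vectors -/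

namespace PseudoRiemannianMetric

section MultivectorFields

variable {n : ℕ} {M : Type*} [TopologicalSpace M]
  [ChartedSpace (EuclideanSpace ℝ (Fin n)) M] [IsManifold (𝓡 n) ∞ M]
  {g : PseudoRiemannianMetric n M} {p : M} {A B : (x : M) → g.GeomTangent x}

theorem smoothNear_iff : g.SmoothNear A p ↔ ∃ c : Finset (Fin n) → M → ℝ,
    (∀ J, ScalarSmoothNear (n := n) (c J) p) ∧
      ∀ᶠ x in 𝓝 p, A x = ∑ J, c J x • g.coordMultivector p J x := by
  constructor
  · rintro ⟨W, hW, hp, -, c, hc, h⟩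
    exact ⟨c, fun J ↦ ⟨W, hW, hp, hc J⟩, eventually_of_mem (hW.mem_nhds hp) h⟩
  · rintro ⟨c, hc, h⟩
    have h1 : ∀ᶠ x in 𝓝 p, ∀ J, ContMDiffAt (𝓡 n) 𝓘(ℝ, ℝ) ∞ (c J) x :=
      eventually_all.2 fun J ↦ scalarSmoothNear_iff.1 (hc J)
    have h2 : ∀ᶠ x in 𝓝 p, x ∈ (chartAt (EuclideanSpace ℝ (Fin n)) p).source :=
      (chartAt _ p).open_source.mem_nhds (mem_chart_source _ p)
    obtain ⟨W, hW, hWo, hpW⟩ := eventually_nhds_iff.1 (h.and (h1.and h2))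
    exact ⟨W, hWo, hpW, fun x hx ↦ (hW x hx).2.2, c,
      fun J x hx ↦ ((hW x hx).2.1 J).contMDiffWithinAt, fun x hx ↦ (hW x hx).1⟩

namespace SmoothNear

theorem congr (h : g.SmoothNear A p) (e : ∀ᶠ x in 𝓝 p, B x = A x) : g.SmoothNear B p := by
  rw [smoothNear_iff] at h ⊢
  obtain ⟨c, hc, h⟩ := h
  refine ⟨c, hc, ?_⟩
  filter_upwards [h, e] with x h1 h2 using h2.trans h1

theorem add (hA : g.SmoothNear A p) (hB : g.SmoothNear B p) :
    g.SmoothNear (fun x ↦ A x + B x) p := by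
  rw [smoothNear_iff] at hA hB ⊢
  obtain ⟨c, hc, hA⟩ := hA
  obtain ⟨d, hd, hB⟩ := hB
  refine ⟨fun J x ↦ c J x + d J x, fun J ↦ (hc J).add (hd J), ?_⟩
  filter_upwards [hA, hB] with x h1 h2
  simp_rw [h1, h2, add_smul, Finset.sum_add_distrib]

theorem smul {φ : M → ℝ} (hφ : ScalarSmoothNear (n := n) φ p) (hA : g.SmoothNear A p) :
    g.SmoothNear (fun x ↦ φ x • A x) p := by
  rw [smoothNear_iff] at hA ⊢
  obtain ⟨c, hc, hA⟩ := hA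
  refine ⟨fun J x ↦ φ x * c J x, fun J ↦ hφ.mul (hc J), ?_⟩
  filter_upwards [hA] with x h1
  simp_rw [h1, Finset.smul_sum, smul_smul]

theorem zero : g.SmoothNear (fun _ ↦ 0) p :=
  smoothNear_iff.2 ⟨fun _ _ ↦ 0, fun _ ↦ .const 0, .of_forall fun x ↦ by simp⟩

theorem sum {ι : Type*} {s : Finset ι} {f : ι → (x : M) → g.GeomTangent x}
    (h : ∀ i ∈ s, g.SmoothNear (f i) p) : g.SmoothNear (fun x ↦ ∑ i ∈ s, f i x) p := by
  classical
  induction s using Finset.induction_on with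
  | empty => simpa using zero
  | insert a s ha ih =>
    simp only [Finset.sum_insert ha]
    exact (h a (by simp)).add (ih fun i hi ↦ h i (by simp [hi]))

theorem sub (hA : g.SmoothNear A p) (hB : g.SmoothNear B p) :
    g.SmoothNear (fun x ↦ A x - B x) p := by
  simpa [sub_eq_add_neg] using hA.add (hB.smul (.const (-1)))

theorem wedge_coordVector {k : ℕ} (j : Fin k → Fin n) :
    g.SmoothNear (fun x ↦ g.wedge x fun i ↦ coordVector p (j i) x) p := by
  obtain ⟨s, hs⟩ := g.wedge_comp_eq_sum j
  exact smoothNear_iff.2 ⟨fun J _ ↦ s J, fun J ↦ .const _,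
    .of_forall fun x ↦ hs x fun i ↦ coordVector p i x⟩

theorem one : g.SmoothNear (fun _ ↦ 1) p := by
  simpa only [wedge_zero] using wedge_coordVector (g := g) (p := p) Fin.elim0

theorem scalar {φ : M → ℝ} (hφ : ScalarSmoothNear (n := n) φ p) :
    g.SmoothNear (fun x ↦ algebraMap ℝ (g.GeomTangent x) (φ x)) p := by
  simpa only [Algebra.algebraMap_eq_smul_one] using smul hφ one

/-- A fibrewise linear operation maps smooth fields to smooth fields as soon as it does so for the
members of the coordinate multivector frame. -/
theorem linear_of_coordMultivector {T : (x : M) → g.GeomTangent x →ₗ[ℝ] g.GeomTangent x}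
    (hT : ∀ J, g.SmoothNear (fun x ↦ T x (g.coordMultivector p J x)) p)
    (hA : g.SmoothNear A p) : g.SmoothNear (fun x ↦ T x (A x)) p := by
  obtain ⟨c, hc, h⟩ := smoothNear_iff.1 hA
  refine (sum (s := Finset.univ) fun J _ ↦ (hT J).smul (hc J)).congr ?_
  filter_upwards [h] with x hx
  simp [hx]

/-- After expansion of `v` in coordinate vectors, each term on a frame member is again a wedge of
coordinate vectors, possibly unsorted or with a repetition. -/
theorem vecWedge {v : (x : M) → TangentSpace (𝓡 n) x} (hv : VectorSmoothNear v p)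
    (hA : g.SmoothNear A p) : g.SmoothNear (fun x ↦ g.vecWedge x (v x) (A x)) p := by
  obtain ⟨c, hc, h⟩ := g.exists_frame_components (isLocalFrameOn_coordVector p)
    (chartAt _ p).open_source (mem_chart_source _ p) hv
  refine (sum (s := Finset.univ) (f := fun i x ↦
    c i x • g.vecWedge x (coordVector p i x) (A x)) fun i _ ↦ .smul (hc i) ?_).congr ?_
  · refine hA.linear_of_coordMultivector fun J ↦ ?_
    have := wedge_coordVector (g := g) (p := p)
      (Fin.cons i (fun k ↦ J.orderEmbOfFin rfl k) : Fin (J.card + 1) → Fin n)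
    simpa only [wedge_succ, Fin.cons_zero, Fin.cons_succ, coordMultivector] using this
  · filter_upwards [h] with x hx
    simp [hx]

theorem contract {v : (x : M) → TangentSpace (𝓡 n) x} (hv : VectorSmoothNear v p)
    (hA : g.SmoothNear A p) : g.SmoothNear (fun x ↦ g.contract x (v x) (A x)) p := by
  have hE (i) := (isLocalFrameOn_coordVector (n := n) p).vectorSmoothNear
    (chartAt _ p).open_source (mem_chart_source _ p) i
  have key : ∀ (k : ℕ) (j : Fin k → Fin n),
      g.SmoothNear (fun x ↦ g.contract x (v x) (g.wedge x fun i ↦ coordVector p (j i) x)) p := by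
    intro k
    induction k with
    | zero =>
      intro j
      simp only [wedge_zero]
      refine zero.congr (.of_forall fun x ↦ ?_)
      simpa using g.contract_algebraMap x (v x) 1
    | succ k ih =>
      intro j
      simp only [wedge_succ, contract_vecWedge]
      exact ((wedge_coordVector _).smul (g.scalarSmoothNear_inner hv (hE _))).sub
        (vecWedge (hE _) (ih _))
  exact hA.linear_of_coordMultivector fun J ↦ key _ _

/-- Splits the geometric product as `vA = v ∧ A + v ⌟ A`, both parts being smooth. -/
theorem vec_mul {v : (x : M) → TangentSpace (𝓡 n) x} (hv : VectorSmoothNear v p)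
    (hA : g.SmoothNear A p) : g.SmoothNear (fun x ↦ g.vec x (v x) * A x) p :=
  ((vecWedge hv hA).add (contract hv hA)).congr
    (.of_forall fun x ↦ by rw [vecWedge_apply, sub_add_cancel])

theorem vec {v : (x : M) → TangentSpace (𝓡 n) x} (hv : VectorSmoothNear v p) :
    g.SmoothNear (fun x ↦ g.vec x (v x)) p := by
  simpa using vec_mul hv (one (g := g))

theorem scalarPart (hA : g.SmoothNear A p) :
    ScalarSmoothNear (n := n) (fun x ↦ g.scalarPart x (A x)) p := by
  obtain ⟨c, hc, h⟩ := smoothNear_iff.1 hA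
  refine (ScalarSmoothNear.sum (s := Finset.univ) fun J _ ↦ (hc J).mul
    (.const (if J.card = 0 then 1 else 0))).congr ?_
  filter_upwards [h] with x hx
  simp only [hx, map_sum, map_smul, coordMultivector, scalarPart_wedge, smul_eq_mul]

end SmoothNear

/-- The fields generated near `p` by smooth scalar fields, sums, and multiplication with smooth
vector fields. -/
inductive GeneratedNear (g : PseudoRiemannianMetric n M) (p : M) :
    ((x : M) → g.GeomTangent x) → Prop
  | scalar (φ : M → ℝ) (hφ : ScalarSmoothNear (n := n) φ p) :
    GeneratedNear g p fun x ↦ algebraMap ℝ (g.GeomTangent x) (φ x)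
  | add (A B : (x : M) → g.GeomTangent x) (hA : GeneratedNear g p A) (hB : GeneratedNear g p B) :
    GeneratedNear g p fun x ↦ A x + B x
  | vec_mul (v : (x : M) → TangentSpace (𝓡 n) x) (A : (x : M) → g.GeomTangent x)
    (hv : VectorSmoothNear v p) (hA : GeneratedNear g p A) :
    GeneratedNear g p fun x ↦ g.vec x (v x) * A x
  | congr (A B : (x : M) → g.GeomTangent x) (hA : GeneratedNear g p A)
    (h : ∀ᶠ x in 𝓝 p, B x = A x) : GeneratedNear g p B

namespace GeneratedNear

theorem smul {φ : M → ℝ} (hφ : ScalarSmoothNear (n := n) φ p) (hA : GeneratedNear g p A) :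
    GeneratedNear g p fun x ↦ φ x • A x := by
  induction hA with
  | scalar ψ hψ => simpa [Algebra.smul_def] using GeneratedNear.scalar _ (hφ.mul hψ)
  | add A B _ _ hA hB => simpa using GeneratedNear.add _ _ hA hB
  | vec_mul v A hv _ hA => simpa using GeneratedNear.vec_mul v _ hv hA
  | congr A B _ h hA => exact .congr _ _ hA (h.mono fun x hx ↦ by rw [hx])

theorem contract {v : (x : M) → TangentSpace (𝓡 n) x} (hv : VectorSmoothNear v p)
    (hA : GeneratedNear g p A) : GeneratedNear g p fun x ↦ g.contract x (v x) (A x) := by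
  induction hA with
  | scalar ψ hψ =>
    simp only [contract_algebraMap]
    simpa using GeneratedNear.scalar (g := g) (p := p) (fun _ ↦ 0) (.const 0)
  | add A B _ _ hA hB => simpa using GeneratedNear.add _ _ hA hB
  | vec_mul w A hw h hA =>
    simp only [contract_vec_mul]
    simpa [sub_eq_add_neg] using GeneratedNear.add _ _
      (h.smul (g.scalarSmoothNear_inner hv hw)) (smul (.const (-1)) (.vec_mul w _ hw hA))
  | congr A B _ h hA => exact .congr _ _ hA (h.mono fun x hx ↦ by rw [hx])

/-- Read backwards, `v ∧ A = vA - v ⌟ A` writes wedges with the generating operations, once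
contraction is known to preserve generated fields. -/
theorem wedge (k : ℕ) {v : Fin k → (x : M) → TangentSpace (𝓡 n) x}
    (hv : ∀ i, VectorSmoothNear (v i) p) : GeneratedNear g p fun x ↦ g.wedge x fun i ↦ v i x := by
  induction k with
  | zero =>
    simp only [wedge_zero]
    simpa using GeneratedNear.scalar (g := g) (p := p) (fun _ ↦ 1) (.const 1)
  | succ k ih =>
    simp only [wedge_succ, vecWedge_apply]
    have h := ih fun i ↦ hv i.succ
    simpa [sub_eq_add_neg] using GeneratedNear.add _ _
      (.vec_mul _ _ (hv 0) h) (smul (.const (-1)) (contract (hv 0) h))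

end GeneratedNear

theorem SmoothNear.generatedNear (hA : g.SmoothNear A p) : GeneratedNear g p A := by
  obtain ⟨c, hc, h⟩ := smoothNear_iff.1 hA
  refine .congr _ _ ?_ h
  generalize (Finset.univ : Finset (Finset (Fin n))) = s
  induction s using Finset.induction_on with
  | empty => simpa using GeneratedNear.scalar (g := g) (p := p) (fun _ ↦ 0) (.const 0)
  | insert J s hJ ih =>
    simp only [Finset.sum_insert hJ]
    exact .add _ _ (.smul (hc J) (.wedge _ fun i ↦
      (isLocalFrameOn_coordVector (n := n) p).vectorSmoothNear
        (chartAt _ p).open_source (mem_chart_source _ p) _)) ih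

/-- Induction principle for smooth multivector fields. -/
theorem SmoothNear.induction {P : ((x : M) → g.GeomTangent x) → Prop}
    (scalar : ∀ φ : M → ℝ, ScalarSmoothNear (n := n) φ p →
      P fun x ↦ algebraMap ℝ (g.GeomTangent x) (φ x))
    (add : ∀ A B : (x : M) → g.GeomTangent x, g.SmoothNear A p → g.SmoothNear B p → P A → P B →
      P fun x ↦ A x + B x)
    (vec_mul : ∀ (v : (x : M) → TangentSpace (𝓡 n) x) (A : (x : M) → g.GeomTangent x),
      VectorSmoothNear v p → g.SmoothNear A p → P A → P fun x ↦ g.vec x (v x) * A x)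
    (congr : ∀ A B : (x : M) → g.GeomTangent x, g.SmoothNear A p → P A →
      (∀ᶠ x in 𝓝 p, B x = A x) → P B)
    (hA : g.SmoothNear A p) : P A := by
  suffices h : g.SmoothNear A p ∧ P A from h.2
  have hG := hA.generatedNear
  clear hA
  induction hG with
  | scalar φ hφ => exact ⟨.scalar hφ, scalar φ hφ⟩
  | add A B _ _ hA hB => exact ⟨hA.1.add hB.1, add A B hA.1 hB.1 hA.2 hB.2⟩
  | vec_mul v A hv _ hA => exact ⟨SmoothNear.vec_mul hv hA.1, vec_mul v A hv hA.1 hA.2⟩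
  | congr A B _ h hA => exact ⟨hA.1.congr h, congr A B hA.1 hA.2 h⟩

theorem SmoothNear.mul (hA : g.SmoothNear A p) (hB : g.SmoothNear B p) :
    g.SmoothNear (fun x ↦ A x * B x) p := by
  refine hA.induction (P := fun A ↦ g.SmoothNear (fun x ↦ A x * B x) p) ?_ ?_ ?_ ?_
  · intro φ hφ
    simpa [← Algebra.smul_def] using SmoothNear.smul hφ hB
  · intro A A' _ _ h h'
    simpa [add_mul] using h.add h'
  · intro v A hv _ h
    simpa [mul_assoc] using SmoothNear.vec_mul hv h
  · exact fun A A' _ h e ↦ h.congr (e.mono fun x hx ↦ by rw [hx])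

/-- Smoothness near `q` refers to the chart at `q`, not the one at `p`. Induction over the
generators avoids transforming multivector frames, since smoothness of scalar and vector fields is
independent of the chart. -/
theorem SmoothNear.eventually (hA : g.SmoothNear A p) : ∀ᶠ q in 𝓝 p, g.SmoothNear A q := by
  refine hA.induction (P := fun A ↦ ∀ᶠ q in 𝓝 p, g.SmoothNear A q) ?_ ?_ ?_ ?_
  · exact fun φ hφ ↦ hφ.eventually.mono fun q hq ↦ .scalar hq
  · intro A A' _ _ h h'
    filter_upwards [h, h'] with q h1 h2 using h1.add h2
  · intro v A hv _ h
    filter_upwards [h, hv.eventually] with q h1 h2 using SmoothNear.vec_mul h2 h1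
  · intro A A' _ h e
    filter_upwards [h, e.eventually_nhds] with q h1 h2 using h1.congr h2

end MultivectorFields

end PseudoRiemannianMetric

/-! ### Local square roots and congruence of symmetric matrix fields -/

/-- Local square roots near `1` in a Banach algebra. -/
theorem exists_local_sqrt (𝔸 : Type*) [NormedRing 𝔸] [NormedAlgebra ℝ 𝔸] [CompleteSpace 𝔸] :
    ∃ r : 𝔸 → 𝔸, r 1 = 1 ∧ DifferentiableAt ℝ r 1 ∧ (∀ᶠ y in 𝓝 1, r y * r y = y) ∧
      ∀ᶠ X in 𝓝 1, r (X * X) = X := by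
  -- The derivative `X ↦ 2X` of squaring at `1`, invertible as the inverse function theorem
  -- requires.
  let f' : 𝔸 ≃L[ℝ] 𝔸 := ContinuousLinearEquiv.equivOfInverse
    ((2 : ℝ) • ContinuousLinearMap.id ℝ 𝔸) ((1 / 2 : ℝ) • ContinuousLinearMap.id ℝ 𝔸)
    (fun x ↦ by simp [smul_smul]) (fun x ↦ by simp [smul_smul])
  have hf : HasStrictFDerivAt (fun X : 𝔸 ↦ X * X) (f' : 𝔸 →L[ℝ] 𝔸) 1 := by
    refine ((hasStrictFDerivAt_id (𝕜 := ℝ) (1 : 𝔸)).mul' (hasStrictFDerivAt_id _)).congr_fderiv ?_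
    ext X
    simp [f', two_smul]
  have h1 : (1 : 𝔸) * 1 = 1 := mul_one 1
  refine ⟨hf.localInverse _ _ _, ?_, ?_, ?_, ?_⟩
  · simpa using hf.localInverse_apply_image
  · simpa using hf.to_localInverse.hasFDerivAt.differentiableAt
  · simpa using hf.eventually_right_inverse
  · exact hf.eventually_left_inverse

/-- Local square roots near the identity matrix. -/
theorem Matrix.exists_local_sqrt (n : ℕ) :
    ∃ r : Matrix (Fin n) (Fin n) ℝ → Matrix (Fin n) (Fin n) ℝ, r 1 = 1 ∧
      (∀ i j, DifferentiableAt ℝ (fun Y : Fin n → Fin n → ℝ ↦ r (Matrix.of Y) i j)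
        (Matrix.of.symm 1)) ∧
      (∀ᶠ Y in 𝓝 1, r Y * r Y = Y) ∧ ∀ᶠ Y in 𝓝 1, r (Y * Y) = Y := by
  obtain ⟨r, hr1, hrd, hrr, hrl⟩ :=
    _root_.exists_local_sqrt (EuclideanSpace ℝ (Fin n) →L[ℝ] EuclideanSpace ℝ (Fin n))
  -- Operators on Euclidean space form a Banach algebra; this isomorphism carries the square root
  -- over to matrices.
  let τ := (Matrix.toEuclideanCLM (𝕜 := ℝ) (n := Fin n)).toAlgEquiv
  have hτ : Tendsto τ (𝓝 1) (𝓝 1) := by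
    have := (LinearMap.continuous_of_finiteDimensional τ.toLinearMap).tendsto 1
    simpa using this
  refine ⟨fun Y ↦ τ.symm (r (τ Y)), by simp [hr1], fun i j ↦ ?_, ?_, ?_⟩
  · let a : (Fin n → Fin n → ℝ) →ₗ[ℝ] (EuclideanSpace ℝ (Fin n) →L[ℝ] EuclideanSpace ℝ (Fin n)) :=
      τ.toLinearMap ∘ₗ (Matrix.ofLinearEquiv ℝ).toLinearMap
    let b : (EuclideanSpace ℝ (Fin n) →L[ℝ] EuclideanSpace ℝ (Fin n)) →ₗ[ℝ] ℝ :=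
      Matrix.entryLinearMap ℝ ℝ i j ∘ₗ τ.symm.toLinearMap
    have ha : a (Matrix.of.symm 1) = 1 := map_one τ
    have h1 : DifferentiableAt ℝ r (LinearMap.toContinuousLinearMap a (Matrix.of.symm 1)) := by
      rw [LinearMap.coe_toContinuousLinearMap', ha]
      exact hrd
    exact (LinearMap.toContinuousLinearMap b).differentiableAt.comp _
      (h1.comp _ (LinearMap.toContinuousLinearMap a).differentiableAt)
  · filter_upwards [hτ.eventually hrr] with Y hY
    rw [← map_mul, hY, AlgEquiv.symm_apply_apply]
  · filter_upwards [hτ.eventually hrl] with Y hY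
    rw [map_mul, hY, AlgEquiv.symm_apply_apply]

open Matrix in
/-- A field of symmetric matrices `G`, nondegenerate at `p`, is locally congruent to its value at
`p` by a field of matrices that is as differentiable as `G` at `p`. -/
theorem exists_congruence {n : ℕ} {M : Type*} [TopologicalSpace M]
    [ChartedSpace (EuclideanSpace ℝ (Fin n)) M] [IsManifold (𝓡 n) ∞ M] {p : M}
    {G : M → Matrix (Fin n) (Fin n) ℝ} (hG : ∀ i j, ContMDiffAt (𝓡 n) 𝓘(ℝ, ℝ) ∞ (G · i j) p)
    (hsymm : ∀ x, (G x)ᵀ = G x) (hdet : (G p).det ≠ 0) :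
    ∃ X : M → Matrix (Fin n) (Fin n) ℝ, X p = 1 ∧
      (∀ i j, MDifferentiableAt (𝓡 n) 𝓘(ℝ, ℝ) (X · i j) p) ∧
      ∀ᶠ x in 𝓝 p, (X x)ᵀ * G p * X x = G x := by
  obtain ⟨r, hr1, hrd, hrr, hrl⟩ := Matrix.exists_local_sqrt n
  have hu : IsUnit (G p).det := hdet.isUnit
  let N : M → Matrix (Fin n) (Fin n) ℝ := fun x ↦ (G p)⁻¹ * G x
  have hNp : N p = 1 := Matrix.nonsing_inv_mul _ hu
  have hN : MDifferentiableAt (𝓡 n) 𝓘(ℝ, Fin n → Fin n → ℝ) (fun x ↦ Matrix.of.symm (N x)) p := by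
    refine ContMDiffAt.mdifferentiableAt (n := ∞) ?_ (by simp)
    refine contMDiffAt_pi_space.2 fun i ↦ contMDiffAt_pi_space.2 fun j ↦ ?_
    simp only [N, Matrix.of_symm_apply, Matrix.mul_apply]
    exact ContMDiffAt.sum fun k _ ↦ contMDiffAt_const.mul (hG k j)
  let X : M → Matrix (Fin n) (Fin n) ℝ := fun x ↦ r (N x)
  have hX (i j) : MDifferentiableAt (𝓡 n) 𝓘(ℝ, ℝ) (X · i j) p := by
    have h1 : MDifferentiableAt 𝓘(ℝ, Fin n → Fin n → ℝ) 𝓘(ℝ, ℝ)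
        (fun Y : Fin n → Fin n → ℝ ↦ r (Matrix.of Y) i j) (Matrix.of.symm (N p)) := by
      rw [hNp]
      exact (hrd i j).mdifferentiableAt
    exact h1.comp p hN
  have hXp : X p = 1 := by simp only [X, hNp, hr1]
  -- The adjoint for the form `G p`. It reverses products and fixes `N x`, so `σ (X x)` is also a
  -- square root of `N x` near `1`, and local uniqueness gives `σ (X x) = X x`. Then `Xᵀ G(p) X =
  -- G(p) X² = G(p) N = G`, in any signature.
  let σ : Matrix (Fin n) (Fin n) ℝ →ₗ[ℝ] Matrix (Fin n) (Fin n) ℝ :=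
    { toFun := fun Y ↦ (G p)⁻¹ * Yᵀ * G p
      map_add' := by intros; simp [mul_add, add_mul]
      map_smul' := by intros; simp }
  have hσ1 : σ 1 = 1 := by
    simp [σ, Matrix.nonsing_inv_mul _ hu]
  have hXc : Tendsto X (𝓝 p) (𝓝 1) := by
    rw [← hXp]
    exact tendsto_pi_nhds.2 fun i ↦ tendsto_pi_nhds.2 fun j ↦ (hX i j).continuousAt
  have hNc : Tendsto N (𝓝 p) (𝓝 1) := by
    rw [← hNp]
    exact hN.continuousAt
  have hσc : Tendsto (fun x ↦ σ (X x)) (𝓝 p) (𝓝 1) := by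
    have : Tendsto σ (𝓝 1) (𝓝 1) := by
      have := (LinearMap.continuous_of_finiteDimensional σ).tendsto 1
      rwa [hσ1] at this
    exact this.comp hXc
  refine ⟨X, hXp, hX, ?_⟩
  · filter_upwards [hNc.eventually hrr, hσc.eventually hrl] with x h1 h2
    have hs : σ (X x) * σ (X x) = N x := by
      have h3 : (X x)ᵀ * (X x)ᵀ = G x * (G p)⁻¹ := by
        rw [← Matrix.transpose_mul, h1, Matrix.transpose_mul, hsymm, Matrix.transpose_nonsing_inv,
          hsymm]
      calc σ (X x) * σ (X x) = (G p)⁻¹ * ((X x)ᵀ * (G p * (G p)⁻¹) * (X x)ᵀ) * G p := by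
            simp only [σ, LinearMap.coe_mk, AddHom.coe_mk, mul_assoc]
        _ = (G p)⁻¹ * (G x * ((G p)⁻¹ * G p)) := by
            rw [Matrix.mul_nonsing_inv _ hu, mul_one, h3]; simp only [mul_assoc]
        _ = N x := by rw [Matrix.nonsing_inv_mul _ hu, mul_one]
    have hself : σ (X x) = X x := by rw [← h2, hs]
    have h4 : (X x)ᵀ * G p = G p * X x := by
      conv_rhs => rw [← hself]
      simp only [σ, LinearMap.coe_mk, AddHom.coe_mk, ← mul_assoc]
      rw [Matrix.mul_nonsing_inv _ hu, one_mul]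
    rw [h4, mul_assoc, h1, ← mul_assoc, Matrix.mul_nonsing_inv _ hu, one_mul]

/-! ### Calculus rules for scalar fields at a point -/

section ScalarDerivative

variable {n : ℕ} {M : Type*} [TopologicalSpace M]
  [ChartedSpace (EuclideanSpace ℝ (Fin n)) M] {p : M} {φ ψ : M → ℝ}

theorem mvfderiv_congr_of_eventuallyEq (h : φ =ᶠ[𝓝 p] ψ) (a : TangentSpace (𝓡 n) p) :
    mvfderiv (𝓡 n) φ p a = mvfderiv (𝓡 n) ψ p a := by
  change mfderiv (𝓡 n) 𝓘(ℝ, ℝ) φ p a = mfderiv (𝓡 n) 𝓘(ℝ, ℝ) ψ p a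
  rw [h.mfderiv_eq]
  rfl

theorem mdifferentiableAt_fun_add (hφ : MDifferentiableAt (𝓡 n) 𝓘(ℝ, ℝ) φ p)
    (hψ : MDifferentiableAt (𝓡 n) 𝓘(ℝ, ℝ) ψ p) :
    MDifferentiableAt (𝓡 n) 𝓘(ℝ, ℝ) (fun x ↦ φ x + ψ x) p :=
  hφ.add hψ

theorem mdifferentiableAt_fun_mul (hφ : MDifferentiableAt (𝓡 n) 𝓘(ℝ, ℝ) φ p)
    (hψ : MDifferentiableAt (𝓡 n) 𝓘(ℝ, ℝ) ψ p) :
    MDifferentiableAt (𝓡 n) 𝓘(ℝ, ℝ) (fun x ↦ φ x * ψ x) p :=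
  hφ.mul hψ

theorem mdifferentiableAt_fun_sum {ι : Type*} (s : Finset ι) {f : ι → M → ℝ}
    (h : ∀ i ∈ s, MDifferentiableAt (𝓡 n) 𝓘(ℝ, ℝ) (f i) p) :
    MDifferentiableAt (𝓡 n) 𝓘(ℝ, ℝ) (fun x ↦ ∑ i ∈ s, f i x) p := by
  classical
  induction s using Finset.induction_on with
  | empty => simpa using mdifferentiableAt_const
  | insert i s hi ih =>
    simp only [Finset.sum_insert hi]
    exact mdifferentiableAt_fun_add (h i (by simp)) (ih fun j hj ↦ h j (by simp [hj]))

theorem mvfderiv_fun_add_apply (hφ : MDifferentiableAt (𝓡 n) 𝓘(ℝ, ℝ) φ p)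
    (hψ : MDifferentiableAt (𝓡 n) 𝓘(ℝ, ℝ) ψ p) (a : TangentSpace (𝓡 n) p) :
    mvfderiv (𝓡 n) (fun x ↦ φ x + ψ x) p a =
      mvfderiv (𝓡 n) φ p a + mvfderiv (𝓡 n) ψ p a := by
  simpa using! congrArg (fun f ↦ f a) (mvfderiv_add hφ hψ)

theorem mvfderiv_fun_mul_apply (hφ : MDifferentiableAt (𝓡 n) 𝓘(ℝ, ℝ) φ p)
    (hψ : MDifferentiableAt (𝓡 n) 𝓘(ℝ, ℝ) ψ p) (a : TangentSpace (𝓡 n) p) :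
    mvfderiv (𝓡 n) (fun x ↦ φ x * ψ x) p a =
      mvfderiv (𝓡 n) φ p a * ψ p + φ p * mvfderiv (𝓡 n) ψ p a := by
  have := congrArg (fun f ↦ f a) (mvfderiv_mul hφ hψ)
  simp only [add_apply, smul_apply, smul_eq_mul] at this
  rw [add_comm, mul_comm _ (ψ p)]
  exact this

theorem mvfderiv_fun_const_apply (c : ℝ) (a : TangentSpace (𝓡 n) p) :
    mvfderiv (𝓡 n) (fun _ : M ↦ c) p a = 0 := by
  rw [mvfderiv_const]; rfl

theorem mvfderiv_fun_sum_apply {ι : Type*} (s : Finset ι) {f : ι → M → ℝ}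
    (h : ∀ i ∈ s, MDifferentiableAt (𝓡 n) 𝓘(ℝ, ℝ) (f i) p) (a : TangentSpace (𝓡 n) p) :
    mvfderiv (𝓡 n) (fun x ↦ ∑ i ∈ s, f i x) p a = ∑ i ∈ s, mvfderiv (𝓡 n) (f i) p a := by
  classical
  induction s using Finset.induction_on with
  | empty => simpa using mvfderiv_fun_const_apply 0 a
  | insert i s hi ih =>
    simp only [Finset.sum_insert hi]
    rw [mvfderiv_fun_add_apply (h i (by simp)) 
      (mdifferentiableAt_fun_sum s fun j hj ↦ h j (by simp [hj])),
      ih fun j hj ↦ h j (by simp [hj])]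

end ScalarDerivative

/-! ### Existence of a directional derivative at a point -/

namespace PseudoRiemannianMetric

variable {n : ℕ} {M : Type*} [TopologicalSpace M]
  [ChartedSpace (EuclideanSpace ℝ (Fin n)) M] [IsManifold (𝓡 n) ∞ M]
  (g : PseudoRiemannianMetric n M) (p : M)

/-- Near `p`, the tangent spaces are isometric to the one at `p`, by isometries that are
differentiable at `p`. -/
theorem exists_isometry_field :
    ∃ S : (x : M) → TangentSpace (𝓡 n) x →ₗ[ℝ] TangentSpace (𝓡 n) p, S p = LinearMap.id ∧
      (∀ᶠ x in 𝓝 p, ∀ v w, g.inner p (S x v) (S x w) = g.inner x v w) ∧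
      ∀ v : (x : M) → TangentSpace (𝓡 n) x, VectorSmoothNear v p →
        ∃ (c : Fin n → M → ℝ) (b : Fin n → TangentSpace (𝓡 n) p),
          (∀ i, MDifferentiableAt (𝓡 n) 𝓘(ℝ, ℝ) (c i) p) ∧
          ∀ᶠ x in 𝓝 p, S x (v x) = ∑ i, c i x • b i := by
  set e := coordVector (n := n) p
  set V := (chartAt (EuclideanSpace ℝ (Fin n)) p).source
  have he : IsLocalFrameOn (𝓡 n) (EuclideanSpace ℝ (Fin n)) ∞ e V := isLocalFrameOn_coordVector p
  have hV : IsOpen V := (chartAt _ p).open_source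
  have hp : p ∈ V := mem_chart_source _ p
  obtain ⟨X, hXp, hX, hXG⟩ := exists_congruence (p := p)
    (G := fun x ↦ Matrix.of fun i j ↦ g.coeff e i j x)
    (fun i j ↦ (g.scalarSmoothNear_coeff he hV hp i j).contMDiffAt)
    (fun x ↦ by ext i j; simp [g.coeff_comm e i j]) (g.coeff_det_ne_zero he hp)
  -- The map with matrix `X x` from the coordinate frame at `x` to the one at `p`; the congruence
  -- says exactly that it is an isometry.
  let S : (x : M) → TangentSpace (𝓡 n) x →ₗ[ℝ] TangentSpace (𝓡 n) p := fun x ↦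
    ∑ i, ∑ j, X x i j • (he.coeff j x).smulRight (e i p)
  have hcoeff {x : M} (hx : x ∈ V) (i j : Fin n) :
      he.coeff i x (e j x) = if j = i then 1 else 0 := by
    rw [he.coeff_apply_of_mem hx, ← he.toBasisAt_coe hx, Module.Basis.repr_self,
      Finsupp.single_apply]
  have hSe {x : M} (hx : x ∈ V) (j : Fin n) : S x (e j x) = ∑ i, X x i j • e i p := by
    simp [S, hcoeff hx]
  refine ⟨S, ?_, ?_, ?_⟩
  · refine (he.toBasisAt hp).ext fun j ↦ ?_
    rw [he.toBasisAt_coe, hSe hp, hXp]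
    simp [Matrix.one_apply]
  · filter_upwards [hXG, hV.mem_nhds hp] with x hx hxV
    have h : LinearMap.compl₁₂ (g.inner p).toLinearMap₁₂ (S x) (S x) =
        (g.inner x).toLinearMap₁₂ := by
      refine LinearMap.ext_basis (he.toBasisAt hxV) (he.toBasisAt hxV) fun j k ↦ ?_
      have := congrFun (congrFun hx j) k
      simp only [he.toBasisAt_coe, LinearMap.compl₁₂_apply, hSe hxV]
      rw [Matrix.mul_assoc, Matrix.mul_apply] at this
      simp only [Matrix.mul_apply, Matrix.transpose_apply, Matrix.of_apply] at this
      change g.inner p (∑ i, X x i j • e i p) (∑ i, X x i k • e i p) = g.inner x (e j x) (e k x)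
      have h (B : TangentSpace (𝓡 n) p →L[ℝ] TangentSpace (𝓡 n) p →L[ℝ] ℝ)
          (c d : Fin n → ℝ) (E : Fin n → TangentSpace (𝓡 n) p) :
          B (∑ i, c i • E i) (∑ i, d i • E i) = ∑ i, c i * ∑ l, B (E i) (E l) * d l := by
        rw [map_sum B, sum_apply]
        simp [mul_comm, Finset.mul_sum, mul_left_comm]
      rw [h (g.inner p)]
      exact this
    exact fun v w ↦ congrArg (fun B ↦ B v w) h
  · intro v hv
    obtain ⟨c, hc, h⟩ := g.exists_frame_components he hV hp hv
    refine ⟨fun i x ↦ ∑ j, c j x * X x i j, fun i ↦ e i p, fun i ↦ ?_, ?_⟩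
    · exact mdifferentiableAt_fun_sum _ fun j _ ↦
        mdifferentiableAt_fun_mul (hc j).mdifferentiableAt (hX i j)
    · filter_upwards [h, hV.mem_nhds hp] with x hx hxV
      rw [hx, map_sum]
      simp only [map_smul, hSe hxV, Finset.smul_sum, smul_smul, Finset.sum_smul]
      exact Finset.sum_comm

/-- The geometric algebras at points near `p` can be transported to the one at `p` by algebra
isomorphisms that are differentiable at `p`. -/
theorem exists_transport :
    ∃ Φ : (x : M) → g.GeomTangent x →ₗ[ℝ] g.GeomTangent p, Φ p = LinearMap.id ∧
      (∀ᶠ x in 𝓝 p, ∀ r : ℝ, Φ x (algebraMap ℝ _ r) = algebraMap ℝ _ r) ∧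
      (∀ᶠ x in 𝓝 p, ∀ A B, Φ x (A * B) = Φ x A * Φ x B) ∧
      ∀ v : (x : M) → TangentSpace (𝓡 n) x, VectorSmoothNear v p →
        ∃ (c : Fin n → M → ℝ) (b : Fin n → TangentSpace (𝓡 n) p),
          (∀ i, MDifferentiableAt (𝓡 n) 𝓘(ℝ, ℝ) (c i) p) ∧
          ∀ᶠ x in 𝓝 p, Φ x (g.vec x (v x)) = ∑ i, c i x • g.vec p (b i) := by
  classical
  obtain ⟨S, hSp, hS, hSv⟩ := g.exists_isometry_field p
  -- Functoriality of the Clifford algebra where `S x` preserves the form. The value zero elsewhere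
  -- is harmless, as only points near `p` matter.
  let Φ (x : M) : g.GeomTangent x →ₗ[ℝ] g.GeomTangent p :=
    if h : ∀ v, g.inner p (S x v) (S x v) = g.inner x v v then
      (CliffordAlgebra.map (Q₁ := g.quadraticForm x) (Q₂ := g.quadraticForm p)
        { S x with map_app' := h }).toLinearMap
    else 0
  have hΦ : ∀ᶠ x in 𝓝 p, ∃ f : g.GeomTangent x →ₐ[ℝ] g.GeomTangent p,
      Φ x = f.toLinearMap ∧ ∀ v, f (g.vec x v) = g.vec p (S x v) := by
    filter_upwards [hS] with x hx
    have h : ∀ v, g.inner p (S x v) (S x v) = g.inner x v v := fun v ↦ hx v v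
    exact ⟨_, dif_pos h, fun v ↦ CliffordAlgebra.map_apply_ι _ _⟩
  refine ⟨Φ, ?_, ?_, ?_, fun v hv ↦ ?_⟩
  · obtain ⟨f, h1, h2⟩ := hΦ.self_of_nhds
    have : f = AlgHom.id ℝ _ := by
      refine CliffordAlgebra.hom_ext (LinearMap.ext fun v ↦ ?_)
      simpa [hSp] using h2 v
    rw [h1, this]
    rfl
  · filter_upwards [hΦ] with x ⟨f, h1, h2⟩ r
    rw [h1]
    exact f.commutes r
  · filter_upwards [hΦ] with x ⟨f, h1, h2⟩ A B
    rw [h1]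
    exact map_mul f A B
  · obtain ⟨c, b, hc, h⟩ := hSv v hv
    refine ⟨c, b, hc, ?_⟩
    filter_upwards [hΦ, h] with x ⟨f, h1, h2⟩ h3
    rw [h1]
    refine (h2 _).trans ?_
    simp [h3]

/-- The axioms of a multivector directional derivative at the point `p`. -/
structure IsDerivativeAt
    (δ : TangentSpace (𝓡 n) p → ((x : M) → g.GeomTangent x) → g.GeomTangent p) : Prop where
  linear_direction (α β : ℝ) (a b : TangentSpace (𝓡 n) p) (A : (x : M) → g.GeomTangent x)
    (hA : g.SmoothNear A p) : δ (α • a + β • b) A = α • δ a A + β • δ b A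
  scalar (a : TangentSpace (𝓡 n) p) (φ : M → ℝ) (hφ : ScalarSmoothNear (n := n) φ p) :
    δ a (fun x ↦ algebraMap ℝ (g.GeomTangent x) (φ x)) =
      algebraMap ℝ (g.GeomTangent p) (mvfderiv (𝓡 n) φ p a)
  vector (a : TangentSpace (𝓡 n) p) (v : (x : M) → TangentSpace (𝓡 n) x)
    (hv : VectorSmoothNear v p) : δ a (fun x ↦ g.vec x (v x)) ∈ LinearMap.range (g.vec p)
  add (a : TangentSpace (𝓡 n) p) (A B : (x : M) → g.GeomTangent x)
    (hA : g.SmoothNear A p) (hB : g.SmoothNear B p) :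
    δ a (fun x ↦ A x + B x) = δ a A + δ a B
  mul (a : TangentSpace (𝓡 n) p) (A B : (x : M) → g.GeomTangent x)
    (hA : g.SmoothNear A p) (hB : g.SmoothNear B p) :
    δ a (fun x ↦ A x * B x) = δ a A * B p + A p * δ a B

/-- Directional derivatives exist at every point. -/
theorem exists_isDerivativeAt : ∃ δ, g.IsDerivativeAt p δ := by
  obtain ⟨Φ, hΦp, hΦr, hΦm, hΦv⟩ := g.exists_transport p
  have hfin : Module.Finite ℝ (g.GeomTangent p) := by
    have h := Module.Finite.of_basis ((isLocalFrameOn_coordVector (n := n) p).toBasisAt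
      (mem_chart_source _ p)).ExteriorAlgebra
    exact Module.Finite.equiv (CliffordAlgebra.equivExterior (g.quadraticForm p)).symm
  let β := Module.finBasis ℝ (g.GeomTangent p)
  -- All functionals `l` are treated at once because the induction step replaces `l` by its
  -- composite with left multiplication by a fixed vector.
  have hmd : ∀ (A : (x : M) → g.GeomTangent x), g.SmoothNear A p →
      ∀ l : Module.Dual ℝ (g.GeomTangent p),
      MDifferentiableAt (𝓡 n) 𝓘(ℝ, ℝ) (fun x ↦ l (Φ x (A x))) p := by
    intro A hA
    refine hA.induction (P := fun A ↦ ∀ l : Module.Dual ℝ (g.GeomTangent p),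
      MDifferentiableAt (𝓡 n) 𝓘(ℝ, ℝ) (fun x ↦ l (Φ x (A x))) p) ?_ ?_ ?_ ?_
    · intro φ hφ l
      have h1 := hφ.mdifferentiableAt.mul (mdifferentiableAt_const (c := l 1))
      refine h1.congr_of_eventuallyEq ?_
      filter_upwards [hΦr] with x hx
      rw [hx, Algebra.algebraMap_eq_smul_one, map_smul]
      rfl
    · intro A B _ _ h h' l
      simpa using mdifferentiableAt_fun_add (h l) (h' l)
    · intro v A hv hA h l
      obtain ⟨c, b, hc, hcb⟩ := hΦv v hv
      have h1 : MDifferentiableAt (𝓡 n) 𝓘(ℝ, ℝ) (fun x ↦ ∑ i, c i x *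
          (l ∘ₗ LinearMap.mulLeft ℝ (g.vec p (b i))) (Φ x (A x))) p :=
        mdifferentiableAt_fun_sum _ fun i _ ↦ mdifferentiableAt_fun_mul (hc i) (h _)
      refine h1.congr_of_eventuallyEq ?_
      filter_upwards [hΦm, hcb] with x hx hx'
      simp [hx, hx', Finset.sum_mul]
    · intro A B _ h e l
      exact (h l).congr_of_eventuallyEq (e.mono fun x hx ↦ by simp only [hx])
  -- The derivative at `p` of the transported field `Φ x (A x)`, which takes values in a fixed
  -- finite-dimensional algebra, computed in the basis `β`.
  let δ (a : TangentSpace (𝓡 n) p) (A : (x : M) → g.GeomTangent x) : g.GeomTangent p :=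
    ∑ m, mvfderiv (𝓡 n) (fun x ↦ β.coord m (Φ x (A x))) p a • β m
  have hδ (a) (A : (x : M) → g.GeomTangent x) (m) :
      β.coord m (δ a A) = mvfderiv (𝓡 n) (fun x ↦ β.coord m (Φ x (A x))) p a := by
    simp [δ, Finsupp.single_apply]
  have hΦA (A : (x : M) → g.GeomTangent x) : Φ p (A p) = A p := by rw [hΦp]; rfl
  refine ⟨δ, ?_, ?_, ?_, ?_, ?_⟩
  · intro α γ a b A _
    simp [δ, add_smul, Finset.sum_add_distrib, Finset.smul_sum, smul_smul]
  · intro a φ hφ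
    refine β.ext_elem fun m ↦ ?_
    rw [← β.coord_apply, ← β.coord_apply, hδ, mvfderiv_congr_of_eventuallyEq
      (ψ := fun x ↦ φ x * β.coord m 1), mvfderiv_fun_mul_apply hφ.mdifferentiableAt
      mdifferentiableAt_const, mvfderiv_fun_const_apply]
    · simp [Algebra.algebraMap_eq_smul_one]
    · filter_upwards [hΦr] with x hx
      rw [hx, Algebra.algebraMap_eq_smul_one, map_smul, smul_eq_mul]
  · intro a v hv
    obtain ⟨c, b, hc, hcb⟩ := hΦv v hv
    refine ⟨∑ i, mvfderiv (𝓡 n) (c i) p a • b i, β.ext_elem fun m ↦ ?_⟩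
    rw [← β.coord_apply, ← β.coord_apply, hδ, mvfderiv_congr_of_eventuallyEq
      (ψ := fun x ↦ ∑ i, c i x * β.coord m (g.vec p (b i))),
      mvfderiv_fun_sum_apply _ fun i _ ↦
        mdifferentiableAt_fun_mul (hc i) mdifferentiableAt_const]
    · simp only [map_sum, map_smul, smul_eq_mul]
      refine Finset.sum_congr rfl fun i _ ↦ ?_
      rw [mvfderiv_fun_mul_apply (hc i) mdifferentiableAt_const, mvfderiv_fun_const_apply]
      simp
    · filter_upwards [hcb] with x hx
      simp [hx]
  · intro a A B hA hB
    refine β.ext_elem fun m ↦ ?_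
    rw [← β.coord_apply, ← β.coord_apply, map_add, hδ, hδ, hδ]
    simp only [map_add]
    exact mvfderiv_fun_add_apply (hmd A hA _) (hmd B hB _) a
  · intro a A B hA hB
    refine β.ext_elem fun m ↦ ?_
    have hprod (x y : g.GeomTangent p) : β.coord m (x * y) =
        ∑ i, ∑ j, (β.coord i x * β.coord j y) * β.coord m (β i * β j) := by
      conv_lhs => rw [← β.sum_repr x, ← β.sum_repr y]
      rw [Finset.sum_mul_sum]
      rw [map_sum]
      refine Finset.sum_congr rfl fun i _ ↦ ?_
      rw [map_sum]
      refine Finset.sum_congr rfl fun j _ ↦ ?_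
      rw [smul_mul_smul_comm, map_smul, smul_eq_mul]
      rfl
    rw [← β.coord_apply, ← β.coord_apply, hδ, mvfderiv_congr_of_eventuallyEq
      (ψ := fun x ↦ ∑ i, ∑ j, (β.coord i (Φ x (A x)) * β.coord j (Φ x (B x))) *
        β.coord m (β i * β j))]
    · have hd (i j) : MDifferentiableAt (𝓡 n) 𝓘(ℝ, ℝ)
          (fun x ↦ (β.coord i (Φ x (A x)) * β.coord j (Φ x (B x))) * β.coord m (β i * β j)) p :=
        mdifferentiableAt_fun_mul (mdifferentiableAt_fun_mul (hmd A hA _) (hmd B hB _))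
          mdifferentiableAt_const
      rw [mvfderiv_fun_sum_apply _ fun i _ ↦ mdifferentiableAt_fun_sum _ fun j _ ↦ hd i j, map_add,
        hprod, hprod, ← Finset.sum_add_distrib]
      refine Finset.sum_congr rfl fun i _ ↦ ?_
      rw [mvfderiv_fun_sum_apply _ fun j _ ↦ hd i j, ← Finset.sum_add_distrib]
      refine Finset.sum_congr rfl fun j _ ↦ ?_
      rw [mvfderiv_fun_mul_apply (mdifferentiableAt_fun_mul (hmd A hA _) (hmd B hB _))
          mdifferentiableAt_const,
        mvfderiv_fun_mul_apply (hmd A hA _) (hmd B hB _), mvfderiv_fun_const_apply, hδ, hδ,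
        hΦA, hΦA]
      ring
    · filter_upwards [hΦm] with x hx
      rw [hx, hprod]

end PseudoRiemannianMetric

/-! ### Locality, metric compatibility and modification of derivatives -/

namespace PseudoRiemannianMetric

variable {n : ℕ} {M : Type*} [TopologicalSpace M]
  [ChartedSpace (EuclideanSpace ℝ (Fin n)) M] [IsManifold (𝓡 n) ∞ M]
  {g : PseudoRiemannianMetric n M} {p : M}

theorem eq_sum_frame (g : PseudoRiemannianMetric n M)
    {e : Fin n → (x : M) → TangentSpace (𝓡 n) x} {V : Set M}
    (he : IsLocalFrameOn (𝓡 n) (EuclideanSpace ℝ (Fin n)) ∞ e V) {x : M} (hx : x ∈ V)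
    (v : TangentSpace (𝓡 n) x) : v = ∑ k, g.inner x v (g.reciprocal e k x) • e k x := by
  rw [← sub_eq_zero]
  refine g.nondegenerate x _ fun u ↦ ?_
  conv_lhs => rw [map_sub, sub_apply]; enter [1]; rw [g.eq_sum_reciprocal he hx u]
  simp [g.symm x u, mul_comm]

variable (g p) in
/-- The vector part of a multivector. -/
noncomputable def vectorPart : g.GeomTangent p →ₗ[ℝ] TangentSpace (𝓡 n) p :=
  ExteriorAlgebra.ιInv ∘ₗ (CliffordAlgebra.equivExterior (g.quadraticForm p)).toLinearMap

theorem vectorPart_vec (v : TangentSpace (𝓡 n) p) : g.vectorPart p (g.vec p v) = v := by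
  have : CliffordAlgebra.equivExterior (g.quadraticForm p) (g.vec p v) =
      ExteriorAlgebra.ι ℝ v := by
    simp [vec, CliffordAlgebra.equivExterior, CliffordAlgebra.changeFormEquiv]
  rw [vectorPart, LinearMap.comp_apply, LinearEquiv.coe_coe, this]
  exact ExteriorAlgebra.ι_leftInverse v

/-- The derivative of a vector field, as a tangent vector. -/
noncomputable def nabla
    (δ : TangentSpace (𝓡 n) p → ((x : M) → g.GeomTangent x) → g.GeomTangent p)
    (a : TangentSpace (𝓡 n) p) (v : (x : M) → TangentSpace (𝓡 n) x) : TangentSpace (𝓡 n) p :=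
  g.vectorPart p (δ a fun x ↦ g.vec x (v x))

namespace IsDerivativeAt

variable {δ δ' : TangentSpace (𝓡 n) p → ((x : M) → g.GeomTangent x) → g.GeomTangent p}
  {A B : (x : M) → g.GeomTangent x} {v w : (x : M) → TangentSpace (𝓡 n) x} {φ : M → ℝ}
  {e : Fin n → (x : M) → TangentSpace (𝓡 n) x} {V : Set M}

/-- The derivative as a linear map in the direction. -/
def toLinearMap (h : g.IsDerivativeAt p δ) (hA : g.SmoothNear A p) :
    TangentSpace (𝓡 n) p →ₗ[ℝ] g.GeomTangent p where
  toFun a := δ a A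
  map_add' a b := by simpa using h.linear_direction 1 1 a b A hA
  map_smul' α a := by simpa using h.linear_direction α 0 a 0 A hA

theorem smul (h : g.IsDerivativeAt p δ)
    (hφ : ScalarSmoothNear (n := n) φ p) (hA : g.SmoothNear A p)
    (a : TangentSpace (𝓡 n) p) :
    δ a (fun x ↦ φ x • A x) = mvfderiv (𝓡 n) φ p a • A p + φ p • δ a A := by
  have := h.mul a _ _ (.scalar hφ) hA
  simpa [h.scalar a φ hφ, ← Algebra.smul_def] using this

theorem zero (h : g.IsDerivativeAt p δ)
    (a : TangentSpace (𝓡 n) p) : δ a (fun _ ↦ 0) = 0 := by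
  have := h.scalar a (fun _ ↦ 0) (.const 0)
  simpa [mvfderiv_fun_const_apply] using this

theorem sum (h : g.IsDerivativeAt p δ)
    {ι : Type*} (s : Finset ι) {f : ι → (x : M) → g.GeomTangent x}
    (hf : ∀ i ∈ s, g.SmoothNear (f i) p) (a : TangentSpace (𝓡 n) p) :
    δ a (fun x ↦ ∑ i ∈ s, f i x) = ∑ i ∈ s, δ a (f i) := by
  classical
  induction s using Finset.induction_on with
  | empty => simpa using h.zero a
  | insert i s hi ih =>
    simp only [Finset.sum_insert hi]
    rw [h.add a _ _ (hf i (by simp)) (.sum fun j hj ↦ hf j (by simp [hj])),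
      ih fun j hj ↦ hf j (by simp [hj])]

/-- The derivative of a field at `p` depends only on the field near `p`. -/
theorem congr (h : g.IsDerivativeAt p δ)
    (hA : g.SmoothNear A p) (e : ∀ᶠ x in 𝓝 p, B x = A x) (a : TangentSpace (𝓡 n) p) :
    δ a B = δ a A := by
  classical
  -- The indicator of the set where the fields agree is `1` near `p`, hence smooth there with zero
  -- derivative, while `φ A = φ B` holds everywhere. The product rule then gives locality.
  let φ : M → ℝ := fun x ↦ if B x = A x then 1 else 0
  have h1 : φ =ᶠ[𝓝 p] fun _ ↦ 1 := e.mono fun x hx ↦ by simp [φ, hx]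
  have hφ : ScalarSmoothNear (n := n) φ p := (ScalarSmoothNear.const 1).congr h1
  have hAB : (fun x ↦ φ x • A x) = fun x ↦ φ x • B x := by
    funext x
    by_cases hx : B x = A x <;> simp [φ, hx]
  have hd : mvfderiv (𝓡 n) φ p a = 0 := by
    rw [mvfderiv_congr_of_eventuallyEq h1, mvfderiv_fun_const_apply]
  have h2 := h.smul hφ hA a
  have h3 := h.smul hφ (hA.congr e) a
  rw [hd, h1.self_of_nhds, zero_smul, zero_add, one_smul] at h2 h3
  rw [← h2, ← h3, hAB]

theorem vec_nabla (h : g.IsDerivativeAt p δ)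
    (hv : VectorSmoothNear v p) (a : TangentSpace (𝓡 n) p) :
    g.vec p (g.nabla δ a v) = δ a fun x ↦ g.vec x (v x) := by
  obtain ⟨w, hw⟩ := h.vector a v hv
  rw [nabla, ← hw, vectorPart_vec]

theorem nabla_add_direction (h : g.IsDerivativeAt p δ)
    (hv : VectorSmoothNear v p) (a b : TangentSpace (𝓡 n) p) :
    g.nabla δ (a + b) v = g.nabla δ a v + g.nabla δ b v := by
  simp only [nabla, ← map_add]
  exact congrArg _ ((h.toLinearMap (.vec hv)).map_add a b)

theorem nabla_smul_direction (h : g.IsDerivativeAt p δ)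
    (hv : VectorSmoothNear v p) (c : ℝ) (a : TangentSpace (𝓡 n) p) :
    g.nabla δ (c • a) v = c • g.nabla δ a v := by
  simp only [nabla, ← map_smul]
  exact congrArg _ ((h.toLinearMap (.vec hv)).map_smul c a)

theorem nabla_sum_direction (h : g.IsDerivativeAt p δ)
    (hv : VectorSmoothNear v p) {ι : Type*} (s : Finset ι)
    (c : ι → ℝ) (a : ι → TangentSpace (𝓡 n) p) :
    g.nabla δ (∑ i ∈ s, c i • a i) v = ∑ i ∈ s, c i • g.nabla δ (a i) v := by
  have h1 := map_sum (h.toLinearMap (.vec hv)) (fun i ↦ c i • a i) s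
  have h2 := congrArg (g.vectorPart p) h1
  rw [map_sum (g.vectorPart p)] at h2
  refine h2.trans (Finset.sum_congr rfl fun i _ ↦ ?_)
  rw [map_smul, map_smul]
  rfl

theorem nabla_add (h : g.IsDerivativeAt p δ)
    (hv : VectorSmoothNear v p) (hw : VectorSmoothNear w p)
    (a : TangentSpace (𝓡 n) p) :
    g.nabla δ a (fun x ↦ v x + w x) = g.nabla δ a v + g.nabla δ a w := by
  simp only [nabla, ← map_add]
  exact congrArg _ (by simpa using h.add a _ _ (.vec hv) (.vec hw))

theorem nabla_smul (h : g.IsDerivativeAt p δ)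
    (hφ : ScalarSmoothNear (n := n) φ p) (hv : VectorSmoothNear v p)
    (a : TangentSpace (𝓡 n) p) : g.nabla δ a (fun x ↦ φ x • v x) =
      mvfderiv (𝓡 n) φ p a • v p + φ p • g.nabla δ a v := by
  have := congrArg (g.vectorPart p) (h.smul hφ (.vec hv) a)
  rw [map_add, map_smul, map_smul, vectorPart_vec] at this
  simpa [nabla] using this

theorem nabla_congr (h : g.IsDerivativeAt p δ)
    (hv : VectorSmoothNear v p) (e : ∀ᶠ x in 𝓝 p, w x = v x)
    (a : TangentSpace (𝓡 n) p) : g.nabla δ a w = g.nabla δ a v :=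
  congrArg (g.vectorPart p) (h.congr (B := fun x ↦ g.vec x (w x)) (.vec hv)
    (e.mono fun x hx ↦ by rw [hx]) a)

theorem nabla_frame (h : g.IsDerivativeAt p δ)
    {c : Fin n → M → ℝ} (hc : ∀ i, ScalarSmoothNear (n := n) (c i) p)
    (he : ∀ i, VectorSmoothNear (e i) p) (hv : ∀ᶠ x in 𝓝 p, v x = ∑ i, c i x • e i x)
    (a : TangentSpace (𝓡 n) p) : g.nabla δ a v =
      ∑ i, (mvfderiv (𝓡 n) (c i) p a • e i p + c i p • g.nabla δ a (e i)) := by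
  rw [h.nabla_congr (.sum fun i _ ↦ .smul (hc i) (he i)) hv]
  simp only [nabla, map_sum]
  rw [h.sum _ (fun i _ ↦ .vec (.smul (hc i) (he i))), map_sum]
  exact Finset.sum_congr rfl fun i _ ↦ h.nabla_smul (hc i) (he i) a

/-- Compatibility with the metric. -/
theorem mvfderiv_inner (h : g.IsDerivativeAt p δ)
    (hv : VectorSmoothNear v p) (hw : VectorSmoothNear w p)
    (a : TangentSpace (𝓡 n) p) : mvfderiv (𝓡 n) (fun x ↦ g.inner x (v x) (w x)) p a =
      g.inner p (g.nabla δ a v) (w p) + g.inner p (v p) (g.nabla δ a w) := by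
  have hi := g.scalarSmoothNear_inner hv hw
  -- Differentiate both sides of `vw + wv = 2 v · w` and compare scalar parts.
  have h1 := h.scalar a _ ((ScalarSmoothNear.const 2).mul hi)
  simp only [← vec_mul_vec_add_swap] at h1
  rw [h.add a _ _ (.vec_mul hv (.vec hw)) (.vec_mul hw (.vec hv)),
    h.mul a _ _ (.vec hv) (.vec hw), h.mul a _ _ (.vec hw) (.vec hv), ← h.vec_nabla hv,
    ← h.vec_nabla hw, mvfderiv_fun_mul_apply mdifferentiableAt_const hi.mdifferentiableAt,
    mvfderiv_fun_const_apply] at h1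
  have h2 := g.vec_mul_vec_add_swap p (g.nabla δ a v) (w p)
  have h3 := g.vec_mul_vec_add_swap p (v p) (g.nabla δ a w)
  have h4 := congrArg (g.scalarPart p) h1
  have h5 := congrArg (g.scalarPart p) h2
  have h6 := congrArg (g.scalarPart p) h3
  simp only [map_add, scalarPart_algebraMap] at h4 h5 h6
  linarith

/-- Directional derivatives at `p` that agree on a frame are equal. -/
theorem eq_of_nabla_eq (h : g.IsDerivativeAt p δ) (h' : g.IsDerivativeAt p δ')
    (he : IsLocalFrameOn (𝓡 n) (EuclideanSpace ℝ (Fin n)) ∞ e V)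
    (hV : IsOpen V) (hp : p ∈ V)
    (heq : ∀ i j, g.nabla δ (e i p) (e j) = g.nabla δ' (e i p) (e j))
    (hA : g.SmoothNear A p) (a : TangentSpace (𝓡 n) p) : δ a A = δ' a A := by
  have hes := he.vectorSmoothNear hV hp
  have h1 (j) : g.nabla δ a (e j) = g.nabla δ' a (e j) := by
    rw [← (he.toBasisAt hp).sum_repr a]
    simp only [he.toBasisAt_coe]
    rw [h.nabla_sum_direction (hes j), h'.nabla_sum_direction (hes j)]
    simp only [heq]
  have h2 (v) (hv : VectorSmoothNear v p) : g.nabla δ a v = g.nabla δ' a v := by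
    obtain ⟨c, hc, hcv⟩ := g.exists_frame_components he hV hp hv
    rw [h.nabla_frame hc hes hcv, h'.nabla_frame hc hes hcv]
    simp only [h1]
  refine hA.induction (P := fun A ↦ δ a A = δ' a A) ?_ ?_ ?_ ?_
  · intro φ hφ
    rw [h.scalar a φ hφ, h'.scalar a φ hφ]
  · intro A B hA hB ihA ihB
    rw [h.add a A B hA hB, h'.add a A B hA hB, ihA, ihB]
  · intro v A hv hA ih
    rw [h.mul a _ A (.vec hv) hA, h'.mul a _ A (.vec hv) hA, ih, ← h.vec_nabla hv,
      ← h'.vec_nabla hv, h2 v hv]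
  · intro A B hA ih hB
    rw [h.congr hA hB, h'.congr hA hB, ih]

/-- A directional derivative at `p` can be modified by any skew endomorphism-valued form. -/
theorem exists_nabla_eq_add (h : g.IsDerivativeAt p δ)
    (he : IsLocalFrameOn (𝓡 n) (EuclideanSpace ℝ (Fin n)) ∞ e V) (hp : p ∈ V)
    (T : TangentSpace (𝓡 n) p →ₗ[ℝ] TangentSpace (𝓡 n) p →ₗ[ℝ] TangentSpace (𝓡 n) p)
    (hT : ∀ a v w, g.inner p (T a v) w + g.inner p v (T a w) = 0) :
    ∃ δ', g.IsDerivativeAt p δ' ∧ ∀ a v, VectorSmoothNear v p →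
      g.nabla δ' a v = g.nabla δ a v + T a (v p) := by
  -- By `key`, the commutator of `xy` with `v` is `2 (v · y) x - 2 (x · v) y`. Summed over `x = T a
  -- e_k`, `y = e^k`, the first term gives `2 T a v`, and by skewness so does the second; hence the
  -- factor `1 / 4`.
  let b (a : TangentSpace (𝓡 n) p) : g.GeomTangent p :=
    (1 / 4 : ℝ) • ∑ k, g.vec p (T a (e k p)) * g.vec p (g.reciprocal e k p)
  have hb (a v : TangentSpace (𝓡 n) p) :
      b a * g.vec p v - g.vec p v * b a = g.vec p (T a v) := by
    have key (x y : TangentSpace (𝓡 n) p) : g.vec p x * g.vec p y * g.vec p v -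
        g.vec p v * (g.vec p x * g.vec p y) =
        g.vec p ((2 * g.inner p v y) • x - (2 * g.inner p x v) • y) := by
      have h1 := g.vec_mul_vec_add_swap p v y
      have h2 := g.vec_mul_vec_add_swap p x v
      rw [Algebra.algebraMap_eq_smul_one] at h1 h2
      rw [map_sub, map_smul, map_smul]
      have h3 := congrArg (g.vec p x * ·) h1
      have h4 := congrArg (· * g.vec p y) h2
      simp only [mul_add, add_mul, mul_smul_comm, smul_mul_assoc, mul_one, one_mul] at h3 h4
      rw [← h3, ← h4]
      simp only [mul_assoc]
      abel
    have h5 : ∑ k, g.inner p v (g.reciprocal e k p) • T a (e k p) = T a v := by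
      conv_rhs => rw [g.eq_sum_frame he hp v]
      simp
    have h6 : ∑ k, g.inner p (T a (e k p)) v • g.reciprocal e k p = - T a v := by
      conv_rhs => rw [g.eq_sum_reciprocal he hp (T a v), ← Finset.sum_neg_distrib]
      refine Finset.sum_congr rfl fun k _ ↦ ?_
      rw [eq_neg_of_add_eq_zero_left (hT a (e k p) v), g.symm p (e k p), neg_smul]
    simp only [b, smul_mul_assoc, mul_smul_comm, ← smul_sub, Finset.sum_mul, Finset.mul_sum,
      ← Finset.sum_sub_distrib, key]
    rw [← map_sum, Finset.sum_sub_distrib]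
    simp only [mul_smul, ← Finset.smul_sum]
    rw [h5, h6, ← map_smul]
    congr 1
    module
  -- A commutator is an inner derivation: it satisfies the product rule and kills scalars, so all
  -- axioms persist.
  refine ⟨fun a A ↦ δ a A + (b a * A p - A p * b a), ⟨?_, ?_, ?_, ?_, ?_⟩, ?_⟩
  · intro α β a a' A hA
    have : b (α • a + β • a') = α • b a + β • b a' := by
      simp only [b, map_add, map_smul, LinearMap.add_apply, LinearMap.smul_apply, add_mul,
        smul_mul_assoc, Finset.sum_add_distrib, ← Finset.smul_sum, smul_add]
      simp only [smul_comm (1 / 4 : ℝ)]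
    rw [h.linear_direction α β a a' A hA, this]
    simp only [add_mul, mul_add, smul_mul_assoc, mul_smul_comm, smul_add, smul_sub]
    abel
  · intro a φ hφ
    rw [h.scalar a φ hφ, Algebra.commutes, sub_self, add_zero]
  · intro a v hv
    rw [hb, ← h.vec_nabla hv, ← map_add]
    exact LinearMap.mem_range_self _ _
  · intro a A B hA hB
    simp only [h.add a A B hA hB, mul_add, add_mul]
    abel
  · intro a A B hA hB
    simp only [h.mul a A B hA hB, mul_add, add_mul, mul_sub, sub_mul, mul_assoc]
    abel
  · intro a v hv
    rw [nabla, hb, map_add, vectorPart_vec]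
    rfl

end IsDerivativeAt

end PseudoRiemannianMetric

/-! ### Connection coefficients and torsion at a point -/

namespace PseudoRiemannianMetric

variable {n : ℕ} {M : Type*} [TopologicalSpace M]
  [ChartedSpace (EuclideanSpace ℝ (Fin n)) M] [IsManifold (𝓡 n) ∞ M]
  {g : PseudoRiemannianMetric n M} {p : M}

theorem frame_induction {e : Fin n → (x : M) → TangentSpace (𝓡 n) x} {V : Set M}
    (he : IsLocalFrameOn (𝓡 n) (EuclideanSpace ℝ (Fin n)) ∞ e V) (hp : p ∈ V)
    {P : TangentSpace (𝓡 n) p → Prop} (frame : ∀ i, P (e i p)) (zero : P 0)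
    (add : ∀ a b, P a → P b → P (a + b)) (smul : ∀ (c : ℝ) a, P a → P (c • a))
    (a : TangentSpace (𝓡 n) p) : P a := by
  have ha : a ∈ Submodule.span ℝ (Set.range (e · p)) := he.generating hp trivial
  induction ha using Submodule.span_induction with
  | mem w hw => obtain ⟨i, rfl⟩ := hw; exact frame i
  | zero => exact zero
  | add a b _ _ ha hb => exact add a b ha hb
  | smul c a _ ha => exact smul c a ha

/-- The connection coefficients at `p` of a directional derivative. -/
noncomputable def connectionCoeff
    (δ : TangentSpace (𝓡 n) p → ((x : M) → g.GeomTangent x) → g.GeomTangent p)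
    (e : Fin n → (x : M) → TangentSpace (𝓡 n) x) (i j k : Fin n) : ℝ :=
  g.inner p (g.nabla δ (e i p) (e j)) (e k p)

/-- The torsion `D_a b - D_b a - [a, b]` at `p` of a directional derivative. -/
noncomputable def torsion
    (δ : TangentSpace (𝓡 n) p → ((x : M) → g.GeomTangent x) → g.GeomTangent p)
    (a b : (x : M) → TangentSpace (𝓡 n) x) : TangentSpace (𝓡 n) p :=
  g.nabla δ (a p) b - g.nabla δ (b p) a - VectorField.mlieBracket (𝓡 n) a b p

namespace IsDerivativeAt

variable {δ δ' : TangentSpace (𝓡 n) p → ((x : M) → g.GeomTangent x) → g.GeomTangent p}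
  {e : Fin n → (x : M) → TangentSpace (𝓡 n) x} {V : Set M}
  {a b c : (x : M) → TangentSpace (𝓡 n) x} {φ : M → ℝ}

theorem connectionCoeff_add_swap (h : g.IsDerivativeAt p δ) (he : ∀ i, VectorSmoothNear (e i) p)
    (i j k : Fin n) : g.connectionCoeff δ e i j k + g.connectionCoeff δ e i k j =
      g.derivCoeff e i j k p := by
  rw [derivCoeff]
  refine Eq.trans ?_ (h.mvfderiv_inner (he j) (he k) (e i p)).symm
  rw [connectionCoeff, connectionCoeff, g.symm p (g.nabla δ (e i p) (e k))]

/-- Every family of numbers that is compatible with the metric is the family of connection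
coefficients of a directional derivative at `p`. -/
theorem exists_connectionCoeff_eq
    (he : IsLocalFrameOn (𝓡 n) (EuclideanSpace ℝ (Fin n)) ∞ e V) (hV : IsOpen V) (hp : p ∈ V)
    (Γ : Fin n → Fin n → Fin n → ℝ)
    (hΓ : ∀ i j k, Γ i j k + Γ i k j = g.derivCoeff e i j k p) :
    ∃ δ, g.IsDerivativeAt p δ ∧ ∀ i j k, g.connectionCoeff δ e i j k = Γ i j k := by
  obtain ⟨δ, hδ⟩ := g.exists_isDerivativeAt p
  have hes := he.vectorSmoothNear hV hp
  let B := he.toBasisAt hp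
  let T : TangentSpace (𝓡 n) p →ₗ[ℝ] TangentSpace (𝓡 n) p →ₗ[ℝ] TangentSpace (𝓡 n) p :=
    B.constr ℝ fun i ↦ B.constr ℝ fun j ↦
      ∑ k, (Γ i j k - g.connectionCoeff δ e i j k) • g.reciprocal e k p
  have hTe (i j) : T (e i p) (e j p) =
      ∑ k, (Γ i j k - g.connectionCoeff δ e i j k) • g.reciprocal e k p := by
    have hB (i) : B i = e i p := he.toBasisAt_coe hp i
    rw [← hB i, ← hB j, B.constr_basis, B.constr_basis]
  have hT (i j k) : g.inner p (T (e i p) (e j p)) (e k p) =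
      Γ i j k - g.connectionCoeff δ e i j k := by
    rw [hTe]
    simp [g.inner_reciprocal he hp]
  -- Both families have the same symmetrization `∂_{e_i} g_jk` in the last two indices, so their
  -- difference is skew.
  have hskew (u v w) : g.inner p (T u v) w + g.inner p v (T u w) = 0 := by
    refine frame_induction he hp (P := fun u ↦ ∀ v w,
      g.inner p (T u v) w + g.inner p v (T u w) = 0) (fun i ↦ ?_) (by simp) ?_ ?_ u v w
    · refine frame_induction he hp (fun j ↦ ?_) (by simp) ?_ ?_
      · refine frame_induction he hp (fun k ↦ ?_) (by simp) ?_ ?_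
        · rw [g.symm p (e j p), hT, hT]
          linarith [hΓ i j k, hδ.connectionCoeff_add_swap hes i j k]
        · intro w w' h h'
          simp only [map_add]
          linarith
        · intro r w h
          simp only [map_smul, smul_eq_mul]
          linear_combination r * h
      · intro v v' h h' w
        simp only [map_add, add_apply]
        linarith [h w, h' w]
      · intro r v h w
        simp only [map_smul, smul_apply, smul_eq_mul]
        linear_combination r * h w
    · intro u u' h h' v w
      simp only [map_add, LinearMap.add_apply, add_apply]
      linarith [h v w, h' v w]
    · intro r u h v w
      simp only [map_smul, LinearMap.smul_apply, smul_apply, smul_eq_mul]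
      linear_combination r * h v w
  obtain ⟨δ', hδ', h⟩ := hδ.exists_nabla_eq_add he hp T hskew
  refine ⟨δ', hδ', fun i j k ↦ ?_⟩
  rw [connectionCoeff, h _ _ (hes j), map_add, add_apply, hT, connectionCoeff]
  ring

/-- Directional derivatives at `p` with the same connection coefficients are equal. -/
theorem eq_of_connectionCoeff_eq (h : g.IsDerivativeAt p δ) (h' : g.IsDerivativeAt p δ')
    (he : IsLocalFrameOn (𝓡 n) (EuclideanSpace ℝ (Fin n)) ∞ e V) (hV : IsOpen V) (hp : p ∈ V)
    (heq : ∀ i j k, g.connectionCoeff δ e i j k = g.connectionCoeff δ' e i j k)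
    {A : (x : M) → g.GeomTangent x} (hA : g.SmoothNear A p) (a : TangentSpace (𝓡 n) p) :
    δ a A = δ' a A := by
  refine h.eq_of_nabla_eq h' he hV hp (fun i j ↦ ?_) hA a
  rw [g.eq_sum_reciprocal he hp (g.nabla δ (e i p) (e j)),
    g.eq_sum_reciprocal he hp (g.nabla δ' (e i p) (e j))]
  exact Finset.sum_congr rfl fun k _ ↦ congrArg (· • _) (heq i j k)

theorem torsion_swap : g.torsion δ a b = -g.torsion δ b a := by
  rw [torsion, torsion, VectorField.mlieBracket_swap_apply]
  abel

theorem torsion_add_left (h : g.IsDerivativeAt p δ) (ha : VectorSmoothNear a p)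
    (hb : VectorSmoothNear b p) (hc : VectorSmoothNear c p) :
    g.torsion δ (fun x ↦ a x + b x) c = g.torsion δ a c + g.torsion δ b c := by
  have h1 := VectorField.mlieBracket_add_left (W := c) ha.mdifferentiableAt hb.mdifferentiableAt
  have h2 : VectorField.mlieBracket (𝓡 n) (fun x ↦ a x + b x) c p = _ := h1
  rw [torsion, h2, h.nabla_add_direction hc, h.nabla_add ha hb, torsion, torsion]
  abel

/-- Tensoriality: the derivative of `φ` from differentiating `φ a` along `c` cancels the one from
the bracket. -/
theorem torsion_smul_left (h : g.IsDerivativeAt p δ) (hφ : ScalarSmoothNear (n := n) φ p)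
    (ha : VectorSmoothNear a p) (hc : VectorSmoothNear c p) :
    g.torsion δ (fun x ↦ φ x • a x) c = φ p • g.torsion δ a c := by
  have : IsManifold (𝓡 n) (minSmoothness ℝ 2) M := by
    rw [minSmoothness_of_isRCLikeNormedField]; infer_instance
  have h1 := VectorField.mlieBracket_smul_left (W := c) hφ.mdifferentiableAt ha.mdifferentiableAt
  have h2 : VectorField.mlieBracket (𝓡 n) (fun x ↦ φ x • a x) c p = _ := h1
  rw [torsion, h2, h.nabla_smul_direction hc, h.nabla_smul hφ ha, torsion]
  module

theorem torsion_congr_left (h : g.IsDerivativeAt p δ) (ha : VectorSmoothNear a p)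
    (hab : ∀ᶠ x in 𝓝 p, b x = a x) : g.torsion δ b c = g.torsion δ a c := by
  rw [torsion, torsion, h.nabla_congr ha hab, hab.self_of_nhds,
    Filter.EventuallyEq.mlieBracket_vectorField_eq hab
      (Filter.EventuallyEq.refl _ c)]

theorem torsion_eq_zero_of_frame_left (h : g.IsDerivativeAt p δ)
    (he : IsLocalFrameOn (𝓡 n) (EuclideanSpace ℝ (Fin n)) ∞ e V) (hV : IsOpen V) (hp : p ∈ V)
    (hc : VectorSmoothNear c p) (hτ : ∀ i, g.torsion δ (e i) c = 0) (ha : VectorSmoothNear a p) :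
    g.torsion δ a c = 0 := by
  have hes := he.vectorSmoothNear hV hp
  obtain ⟨r, hr, hra⟩ := g.exists_frame_components he hV hp ha
  rw [h.torsion_congr_left (.sum fun i _ ↦ .smul (hr i) (hes i)) hra]
  generalize (Finset.univ : Finset (Fin n)) = s
  induction s using Finset.induction_on with
  | empty =>
    -- The zero field is treated as `0 • a`.
    have := h.torsion_smul_left (.const 0) ha hc
    simpa using this
  | insert i s hi ih =>
    simp only [Finset.sum_insert hi]
    rw [h.torsion_add_left (.smul (hr i) (hes i)) (.sum fun i _ ↦ .smul (hr i) (hes i)) hc, ih,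
      h.torsion_smul_left (hr i) (hes i) hc, hτ, smul_zero, add_zero]

/-- The torsion vanishes as soon as it vanishes on a frame. -/
theorem torsion_eq_zero_of_frame (h : g.IsDerivativeAt p δ)
    (he : IsLocalFrameOn (𝓡 n) (EuclideanSpace ℝ (Fin n)) ∞ e V) (hV : IsOpen V) (hp : p ∈ V)
    (hτ : ∀ i j, g.torsion δ (e i) (e j) = 0) (ha : VectorSmoothNear a p)
    (hb : VectorSmoothNear b p) : g.torsion δ a b = 0 := by
  refine h.torsion_eq_zero_of_frame_left he hV hp hb (fun i ↦ ?_) ha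
  rw [torsion_swap, h.torsion_eq_zero_of_frame_left he hV hp (he.vectorSmoothNear hV hp i)
    (fun j ↦ hτ j i) hb, neg_zero]

theorem inner_torsion (e : Fin n → (x : M) → TangentSpace (𝓡 n) x) (i j k : Fin n) :
    g.inner p (g.torsion δ (e i) (e j)) (e k p) =
      g.connectionCoeff δ e i j k - g.connectionCoeff δ e j i k - g.bracketCoeff e i j k p := by
  rw [torsion, map_sub, map_sub]
  rfl

/-- The torsion vanishes exactly if the connection coefficients are the Levi-Civita
coefficients. -/
theorem torsion_eq_zero_iff (h : g.IsDerivativeAt p δ)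
    (he : IsLocalFrameOn (𝓡 n) (EuclideanSpace ℝ (Fin n)) ∞ e V) (hV : IsOpen V) (hp : p ∈ V) :
    (∀ a b, VectorSmoothNear a p → VectorSmoothNear b p → g.torsion δ a b = 0) ↔
      ∀ i j k, g.connectionCoeff δ e i j k = g.leviCivitaCoeff e i j k p := by
  have hes := he.vectorSmoothNear hV hp
  constructor
  · intro hτ
    have h1 (i j k) : g.connectionCoeff δ e i j k - g.connectionCoeff δ e j i k =
        g.bracketCoeff e i j k p := by
      have := inner_torsion (δ := δ) e i j k
      rw [hτ _ _ (hes i) (hes j), map_zero, zero_apply] at this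
      linarith
    have h2 := h.connectionCoeff_add_swap hes
    have h3 (i j k) := g.leviCivitaCoeff_add_swap e i j k p
    have h4 (i j k) := g.leviCivitaCoeff_sub_swap e i j k p
    intro i j k
    -- The Koszul argument: the difference of the two families is symmetric in `i, j` and
    -- antisymmetric in `j, k`, so cyclic permutation forces it to vanish.
    linarith [h1 i j k, h1 j k i, h1 k i j, h2 i j k, h2 j k i, h2 k i j,
      h3 i j k, h3 j k i, h3 k i j, h4 i j k, h4 j k i, h4 k i j]
  · intro hΓ a b ha hb
    refine h.torsion_eq_zero_of_frame he hV hp (fun i j ↦ ?_) ha hb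
    refine g.eq_zero_of_inner_frame_eq_zero he hp fun k ↦ ?_
    rw [inner_torsion, hΓ, hΓ, g.leviCivitaCoeff_sub_swap, sub_self]

end IsDerivativeAt

/-- A field of directional derivatives with smooth connection coefficients sends smooth fields to
smooth fields. -/
theorem smoothNear_of_connectionCoeff
    {δ : (q : M) → TangentSpace (𝓡 n) q → ((x : M) → g.GeomTangent x) → g.GeomTangent q}
    (hδ : ∀ᶠ q in 𝓝 p, g.IsDerivativeAt q (δ q))
    {e : Fin n → (x : M) → TangentSpace (𝓡 n) x} {V : Set M}
    (he : IsLocalFrameOn (𝓡 n) (EuclideanSpace ℝ (Fin n)) ∞ e V) (hV : IsOpen V) (hp : p ∈ V)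
    (hΓ : ∀ i j k, ScalarSmoothNear (n := n) (fun q ↦ g.connectionCoeff (δ q) e i j k) p)
    {a : (x : M) → TangentSpace (𝓡 n) x} (ha : VectorSmoothNear a p)
    {A : (x : M) → g.GeomTangent x} (hA : g.SmoothNear A p) :
    g.SmoothNear (fun q ↦ δ q (a q) A) p := by
  have hes := he.vectorSmoothNear hV hp
  have hVp : ∀ᶠ q in 𝓝 p, q ∈ V := hV.mem_nhds hp
  have hv (v : (x : M) → TangentSpace (𝓡 n) x) (hv : VectorSmoothNear v p) :
      VectorSmoothNear (fun q ↦ g.nabla (δ q) (a q) v) p := by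
    obtain ⟨α, hα, hαa⟩ := g.exists_frame_components he hV hp ha
    obtain ⟨c, hc, hcv⟩ := g.exists_frame_components he hV hp hv
    have hc' : ∀ᶠ q in 𝓝 p, ∀ i, ScalarSmoothNear (n := n) (c i) q :=
      eventually_all.2 fun i ↦ (hc i).eventually
    -- The component formula for `D_a v`, visibly smooth in the base point.
    have h1 : VectorSmoothNear (fun q ↦ ∑ j, (mvfderiv (𝓡 n) (c j) q (a q) • e j q +
        c j q • ∑ i, α i q • ∑ k, g.connectionCoeff (δ q) e i j k • g.reciprocal e k q)) p :=
      .sum fun j _ ↦ .add (.smul (VectorSmoothNear.mvfderiv (hc j) ha) (hes j)) (.smul (hc j) (.sum fun i _ ↦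
        .smul (hα i) (.sum fun k _ ↦ .smul (hΓ i j k) (g.vectorSmoothNear_reciprocal he hV hp k))))
    refine h1.congr ?_
    filter_upwards [hδ, hαa, hcv.eventually_nhds, hc', hVp] with q hq h2 h3 h4 h5
    have hesq := he.vectorSmoothNear hV h5
    rw [hq.nabla_frame h4 hesq h3]
    refine Finset.sum_congr rfl fun j _ ↦ ?_
    conv_lhs => rw [h2]
    rw [hq.nabla_sum_direction (hesq j), h2]
    congr 2
    refine Finset.sum_congr rfl fun i _ ↦ ?_
    congr 1
    exact g.eq_sum_reciprocal he h5 _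
  refine hA.induction (P := fun A ↦ g.SmoothNear (fun q ↦ δ q (a q) A) p) ?_ ?_ ?_ ?_
  · intro φ hφ
    refine (SmoothNear.scalar (VectorSmoothNear.mvfderiv hφ ha)).congr ?_
    filter_upwards [hδ, hφ.eventually] with q hq h2 using hq.scalar _ φ h2
  · intro A B hA hB ihA ihB
    refine (ihA.add ihB).congr ?_
    filter_upwards [hδ, hA.eventually, hB.eventually] with q hq h1 h2 using hq.add _ A B h1 h2
  · intro v A hv' hA ih
    refine ((SmoothNear.vec (hv v hv')).mul hA |>.add (SmoothNear.vec_mul hv' ih)).congr ?_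
    filter_upwards [hδ, hA.eventually, hv'.eventually] with q hq h1 h2
    rw [hq.mul _ _ A (.vec h2) h1, hq.vec_nabla h2]
  · intro A B hA ih hAB
    refine ih.congr ?_
    filter_upwards [hδ, hA.eventually, hAB.eventually_nhds] with q hq h1 h2 using hq.congr h1 h2 _

end PseudoRiemannianMetric

/-! ### From single points to open sets -/

namespace MDD

open PseudoRiemannianMetric

variable {n : ℕ} {M : Type*} [TopologicalSpace M]
  [ChartedSpace (EuclideanSpace ℝ (Fin n)) M] [IsManifold (𝓡 n) ∞ M]
  {g : PseudoRiemannianMetric n M} {U : TopologicalSpace.Opens M}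

theorem isDerivativeAt (D : MDD g U) (p : U) : g.IsDerivativeAt (p : M) (D.toFun p) :=
  ⟨D.linear_direction p, D.scalar p, D.vector p, D.add p, D.mul p⟩

/-- Directional derivatives at all points of `U` form a multivector directional derivative. -/
theorem exists_eq_of_isDerivativeAt
    (δ : (p : U) → TangentSpace (𝓡 n) (p : M) → ((x : M) → g.GeomTangent x) →
      g.GeomTangent (p : M)) (hδ : ∀ p : U, g.IsDerivativeAt (p : M) (δ p)) :
    ∃ D : MDD g U, ∀ (p : U) a A, g.SmoothNear A p → D.toFun p a A = δ p a A := by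
  classical
  refine ⟨{
    toFun := fun p a A ↦ if g.SmoothNear A p then δ p a A else 0
    linear_direction := fun p α β a b A hA ↦ ?_
    scalar := fun p a φ hφ ↦ ?_
    vector := fun p a v hv ↦ ?_
    add := fun p a A B hA hB ↦ ?_
    mul := fun p a A B hA hB ↦ ?_
    outside := fun p a A hA ↦ if_neg hA }, fun p a A hA ↦ if_pos hA⟩
  · simp only [if_pos hA]
    exact (hδ p).linear_direction α β a b A hA
  · rw [if_pos (.scalar hφ)]
    exact (hδ p).scalar a φ hφ
  · rw [if_pos (.vec hv)]
    exact (hδ p).vector a v hv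
  · rw [if_pos hA, if_pos hB, if_pos (hA.add hB)]
    exact (hδ p).add a A B hA hB
  · rw [if_pos hA, if_pos hB, if_pos (hA.mul hB)]
    exact (hδ p).mul a A B hA hB

/-- The frame may vary arbitrarily with the point, so the statement applies on open sets without a
frame. -/
theorem eq_of_connectionCoeff_eq {D D' : MDD g U}
    (e : U → Fin n → (x : M) → TangentSpace (𝓡 n) x) (V : U → Set M)
    (he : ∀ p, IsLocalFrameOn (𝓡 n) (EuclideanSpace ℝ (Fin n)) ∞ (e p) (V p))
    (hV : ∀ p, IsOpen (V p)) (hp : ∀ p : U, (p : M) ∈ V p)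
    (h : ∀ p i j k, g.connectionCoeff (D.toFun p) (e p) i j k =
      g.connectionCoeff (D'.toFun p) (e p) i j k) : D = D' := by
  ext p a A
  by_cases hA : g.SmoothNear A p
  · exact (D.isDerivativeAt p).eq_of_connectionCoeff_eq (D'.isDerivativeAt p) (he p) (hV p) (hp p)
      (h p) hA a
  · rw [D.outside p a A hA, D'.outside p a A hA]

theorem exists_connectionCoeff_eq
    (e : U → Fin n → (x : M) → TangentSpace (𝓡 n) x) (V : U → Set M)
    (he : ∀ p, IsLocalFrameOn (𝓡 n) (EuclideanSpace ℝ (Fin n)) ∞ (e p) (V p))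
    (hV : ∀ p, IsOpen (V p)) (hp : ∀ p : U, (p : M) ∈ V p) (Γ : Fin n → Fin n → Fin n → U → ℝ)
    (hΓ : ∀ i j k p, Γ i j k p + Γ i k j p = g.derivCoeff (e p) i j k p) :
    ∃ D : MDD g U, ∀ p i j k, g.connectionCoeff (D.toFun p) (e p) i j k = Γ i j k p := by
  -- Pointwise choice suffices: an MDD is not required to depend continuously on the point.
  choose δ hδ hδΓ using fun p : U ↦ IsDerivativeAt.exists_connectionCoeff_eq (he p) (hV p) (hp p)
    (fun i j k ↦ Γ i j k p) (fun i j k ↦ hΓ i j k p)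
  obtain ⟨D, hD⟩ := exists_eq_of_isDerivativeAt δ hδ
  refine ⟨D, fun p i j k ↦ ?_⟩
  rw [← hδΓ p i j k, connectionCoeff, connectionCoeff, nabla, nabla,
    hD p _ _ (.vec ((he p).vectorSmoothNear (hV p) (hp p) j))]

theorem isTorsionFree_iff (D : MDD g U) : D.IsTorsionFree ↔
    ∀ (p : U) a b, VectorSmoothNear a (p : M) → VectorSmoothNear b (p : M) →
      g.torsion (D.toFun p) a b = 0 := by
  refine forall_congr' fun p ↦ forall_congr' fun a ↦ forall_congr' fun b ↦
    forall_congr' fun ha ↦ forall_congr' fun hb ↦ ?_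
  rw [← (D.isDerivativeAt p).vec_nabla ha, ← (D.isDerivativeAt p).vec_nabla hb, ← map_sub,
    ← map_sub, ← (g.vec p).map_zero, (g.vec_injective p).eq_iff]
  rfl

/-- The extension by zero of a multivector directional derivative to points outside `U`. -/
noncomputable def extend (D : MDD g U) (q : M) (a : TangentSpace (𝓡 n) q)
    (A : (x : M) → g.GeomTangent x) : g.GeomTangent q :=
  open scoped Classical in if hq : q ∈ U then D.toFun ⟨q, hq⟩ a A else 0

theorem extend_coe (D : MDD g U) (p : U) : D.extend (p : M) = D.toFun p := by
  funext a A
  exact dif_pos p.2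

theorem isDerivativeAt_extend (D : MDD g U) {q : M} (hq : q ∈ U) :
    g.IsDerivativeAt q (D.extend q) := by
  have := D.isDerivativeAt ⟨q, hq⟩
  rwa [← D.extend_coe] at this

theorem preservesSmoothness_iff (D : MDD g U) : D.PreservesSmoothness ↔
    ∀ (p : U) (a : (x : M) → TangentSpace (𝓡 n) x) (A : (x : M) → g.GeomTangent x),
      VectorSmoothNear a (p : M) → g.SmoothNear A p →
        g.SmoothNear (fun q ↦ D.extend q (a q) A) p := by
  constructor
  · intro h p a A ha hA
    obtain ⟨B, hB, h⟩ := h p a A ha hA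
    refine hB.congr ?_
    filter_upwards [U.isOpen.mem_nhds p.2] with q hq
    rw [h ⟨q, hq⟩, ← D.extend_coe]
  · exact fun h p a A ha hA ↦ ⟨_, h p a A ha hA, fun q ↦ by rw [D.extend_coe]⟩

theorem preservesSmoothness_of_frames (D : MDD g U)
    (e : U → Fin n → (x : M) → TangentSpace (𝓡 n) x) (V : U → Set M)
    (he : ∀ p, IsLocalFrameOn (𝓡 n) (EuclideanSpace ℝ (Fin n)) ∞ (e p) (V p))
    (hV : ∀ p, IsOpen (V p)) (hp : ∀ p : U, (p : M) ∈ V p)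
    (hΓ : ∀ (p : U) i j k, ScalarSmoothNear (n := n)
      (fun q ↦ g.connectionCoeff (D.extend q) (e p) i j k) (p : M)) : D.PreservesSmoothness := by
  rw [preservesSmoothness_iff]
  intro p a A ha hA
  exact smoothNear_of_connectionCoeff
    (eventually_of_mem (U.isOpen.mem_nhds p.2) fun q hq ↦ D.isDerivativeAt_extend hq)
    (he p) (hV p) (hp p) (hΓ p) ha hA

section Frame

variable {e : Fin n → (x : M) → TangentSpace (𝓡 n) x}

theorem hasConnectionCoeffs_iff
    (he : IsLocalFrameOn (𝓡 n) (EuclideanSpace ℝ (Fin n)) ∞ e (U : Set M))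
    (D : MDD g U) (Γ : Fin n → Fin n → Fin n → U → ℝ) : D.HasConnectionCoeffs e Γ ↔
      ∀ (p : U) i j k, g.connectionCoeff (D.toFun p) e i j k = Γ i j k p := by
  have hes (p : U) := he.vectorSmoothNear U.isOpen p.2
  refine forall_congr' fun p ↦ forall_congr' fun i ↦ forall_congr' fun j ↦ ?_
  rw [← (D.isDerivativeAt p).vec_nabla (hes p j)]
  simp only [← map_smul]
  rw [← map_sum, (g.vec_injective p).eq_iff]
  constructor
  · intro h k
    rw [connectionCoeff, h]
    simp [g.inner_reciprocal he p.2]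
  · intro h
    rw [g.eq_sum_reciprocal he p.2 (g.nabla _ _ _)]
    exact Finset.sum_congr rfl fun k _ ↦ congrArg (· • _) (h k)

theorem preservesSmoothness_iff_connectionCoeff
    (he : IsLocalFrameOn (𝓡 n) (EuclideanSpace ℝ (Fin n)) ∞ e (U : Set M))
    (D : MDD g U) : D.PreservesSmoothness ↔ ∀ i j k,
      ContMDiff (𝓡 n) 𝓘(ℝ, ℝ) ∞ fun p : U ↦ g.connectionCoeff (D.toFun p) e i j k := by
  have hes (p : U) := he.vectorSmoothNear U.isOpen p.2
  constructor
  · intro h i j k p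
    rw [preservesSmoothness_iff] at h
    have h1 := h p (e i) _ (hes p i) (.vec (hes p j))
    -- Recovers `Γ_ijk = D_{e_i} e_j · e_k` as half the scalar part of the symmetrized geometric
    -- product, and so as a smooth function.
    have h2 := (ScalarSmoothNear.const (1 / 2)).mul
      ((h1.mul (.vec (hes p k))).add (SmoothNear.vec_mul (hes p k) h1)).scalarPart
    have h3 := contMDiffAt_subtype_iff.2 h2.contMDiffAt
    refine h3.congr_of_eventuallyEq (.of_forall fun q ↦ ?_)
    simp only
    rw [D.extend_coe, ← (D.isDerivativeAt q).vec_nabla (hes q j), vec_mul_vec_add_swap,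
      scalarPart_algebraMap, connectionCoeff]
    ring
  · intro h
    refine D.preservesSmoothness_of_frames (fun _ ↦ e) (fun _ ↦ U) (fun _ ↦ he)
      (fun _ ↦ U.isOpen) (fun p ↦ p.2) fun p i j k ↦ ?_
    rw [scalarSmoothNear_iff]
    filter_upwards [U.isOpen.mem_nhds p.2] with q hq
    refine (contMDiffAt_subtype_iff (x := ⟨q, hq⟩)).1 ?_
    simp only [D.extend_coe]
    exact h i j k _

theorem contMDiff_leviCivitaCoeff (g : PseudoRiemannianMetric n M)
    (he : IsLocalFrameOn (𝓡 n) (EuclideanSpace ℝ (Fin n)) ∞ e (U : Set M)) (i j k : Fin n) :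
    ContMDiff (𝓡 n) 𝓘(ℝ, ℝ) ∞ fun p : U ↦ g.leviCivitaCoeff e i j k p := fun p ↦
  contMDiffAt_subtype_iff.2 (g.scalarSmoothNear_leviCivitaCoeff he U.isOpen p.2 i j k).contMDiffAt

theorem isTorsionFree_iff_connectionCoeff
    (he : IsLocalFrameOn (𝓡 n) (EuclideanSpace ℝ (Fin n)) ∞ e (U : Set M))
    (D : MDD g U) : D.IsTorsionFree ↔ ∀ (p : U) i j k,
      g.connectionCoeff (D.toFun p) e i j k = g.leviCivitaCoeff e i j k p := by
  rw [isTorsionFree_iff]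
  exact forall_congr' fun p ↦ (D.isDerivativeAt p).torsion_eq_zero_iff he U.isOpen p.2

end Frame

end MDD

/-! ### The main theorem -/

open MDD PseudoRiemannianMetric in
theorem mainTheorem8 {n : ℕ} {M : Type*} [TopologicalSpace M]
    [ChartedSpace (EuclideanSpace ℝ (Fin n)) M] [IsManifold (𝓡 n) ∞ M]
    (g : PseudoRiemannianMetric n M) (U : TopologicalSpace.Opens M) :
    (∀ e : Fin n → (x : M) → TangentSpace (𝓡 n) x,
      IsLocalFrameOn (𝓡 n) (EuclideanSpace ℝ (Fin n)) ∞ e (U : Set M) →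
      -- connection coefficients
      (∀ D : MDD g U, ∃! Γ : Fin n → Fin n → Fin n → U → ℝ, D.HasConnectionCoeffs e Γ) ∧
      (∀ (D : MDD g U) (Γ : Fin n → Fin n → Fin n → U → ℝ), D.HasConnectionCoeffs e Γ →
        (∀ i j k p, Γ i j k p + Γ i k j p = g.derivCoeff e i j k p) ∧
        (D.PreservesSmoothness ↔ ∀ i j k, ContMDiff (𝓡 n) 𝓘(ℝ, ℝ) ∞ (Γ i j k))) ∧
      (∀ Γ : Fin n → Fin n → Fin n → U → ℝ,
        (∀ i j k p, Γ i j k p + Γ i k j p = g.derivCoeff e i j k p) →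
        ∃! D : MDD g U, D.HasConnectionCoeffs e Γ) ∧
      -- contorsion coefficients
      (∀ D : MDD g U, ∃! χ : Fin n → Fin n → Fin n → U → ℝ, D.HasContorsionCoeffs e χ) ∧
      (∀ (D : MDD g U) (χ : Fin n → Fin n → Fin n → U → ℝ), D.HasContorsionCoeffs e χ →
        (∀ i j k p, χ i j k p + χ i k j p = 0) ∧
        (D.PreservesSmoothness ↔ ∀ i j k, ContMDiff (𝓡 n) 𝓘(ℝ, ℝ) ∞ (χ i j k)) ∧
        (D.IsTorsionFree ↔ ∀ i j k p, χ i j k p = 0)) ∧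
      (∀ χ : Fin n → Fin n → Fin n → U → ℝ,
        (∀ i j k p, χ i j k p + χ i k j p = 0) →
        ∃! D : MDD g U, D.HasContorsionCoeffs e χ)) ∧
    -- the torsion-free derivative
    ∃ N : MDD g U, N.IsTorsionFree ∧ (∀ D : MDD g U, D.IsTorsionFree → D = N) ∧
      N.PreservesSmoothness ∧
      ∀ (V : TopologicalSpace.Opens M) (hV : V ≤ U)
        (e : Fin n → (x : M) → TangentSpace (𝓡 n) x),
        IsLocalFrameOn (𝓡 n) (EuclideanSpace ℝ (Fin n)) ∞ e (V : Set M) →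
        (N.restrict hV).HasContorsionCoeffs e (fun _ _ _ _ ↦ 0) ∧
        (N.restrict hV).HasConnectionCoeffs e (fun i j k p ↦ g.leviCivitaCoeff e i j k p) := by
  constructor
  · intro e he
    have hes (p : U) := he.vectorSmoothNear U.isOpen p.2
    have hswap (D : MDD g U) (p : U) := (D.isDerivativeAt p).connectionCoeff_add_swap (hes p)
    have hex (Γ : Fin n → Fin n → Fin n → U → ℝ)
        (hΓ : ∀ i j k p, Γ i j k p + Γ i k j p = g.derivCoeff e i j k p) :
        ∃! D : MDD g U, D.HasConnectionCoeffs e Γ := by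
      simp only [hasConnectionCoeffs_iff he]
      obtain ⟨D, hD⟩ := MDD.exists_connectionCoeff_eq (fun _ ↦ e) (fun _ ↦ (U : Set M))
        (fun _ ↦ he) (fun _ ↦ U.isOpen) (fun p ↦ p.2) Γ hΓ
      exact ⟨D, hD, fun D' hD' ↦ MDD.eq_of_connectionCoeff_eq (fun _ ↦ e) (fun _ ↦ (U : Set M))
        (fun _ ↦ he) (fun _ ↦ U.isOpen) (fun p ↦ p.2)
        fun p i j k ↦ (hD' p i j k).trans (hD p i j k).symm⟩
    refine ⟨fun D ↦ ?_, fun D Γ hΓ ↦ ?_, hex, fun D ↦ ?_, fun D χ hχ ↦ ?_, fun χ hχ ↦ ?_⟩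
    · simp only [hasConnectionCoeffs_iff he]
      refine ⟨fun i j k p ↦ g.connectionCoeff (D.toFun p) e i j k, fun _ _ _ _ ↦ rfl, ?_⟩
      intro Γ hΓ
      funext i j k p
      exact (hΓ p i j k).symm
    · rw [hasConnectionCoeffs_iff he] at hΓ
      refine ⟨fun i j k p ↦ ?_, ?_⟩
      · rw [← hΓ, ← hΓ, hswap]
      · rw [preservesSmoothness_iff_connectionCoeff he]
        simp only [hΓ]
    · simp only [HasContorsionCoeffs, hasConnectionCoeffs_iff he]
      refine ⟨fun i j k p ↦ g.connectionCoeff (D.toFun p) e i j k - g.leviCivitaCoeff e i j k p,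
        fun _ _ _ _ ↦ by ring, ?_⟩
      intro χ hχ
      funext i j k p
      rw [hχ p i j k]
      ring
    · rw [HasContorsionCoeffs, hasConnectionCoeffs_iff he] at hχ
      refine ⟨fun i j k p ↦ ?_, ?_, ?_⟩
      · linarith [hχ p i j k, hχ p i k j, hswap D p i j k, g.leviCivitaCoeff_add_swap e i j k p]
      · rw [preservesSmoothness_iff_connectionCoeff he]
        simp only [hχ]
        refine forall_congr' fun i ↦ forall_congr' fun j ↦ forall_congr' fun k ↦ ?_
        have hLC := contMDiff_leviCivitaCoeff g he i j k
        refine ⟨fun h ↦ ?_, fun h ↦ hLC.add h⟩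
        have := h.sub hLC
        simpa using! this
      · rw [isTorsionFree_iff_connectionCoeff he]
        simp only [hχ, add_eq_left]
        exact ⟨fun h i j k p ↦ h p i j k, fun h p i j k ↦ h i j k p⟩
    · refine hex _ fun i j k p ↦ ?_
      linarith [hχ i j k p, g.leviCivitaCoeff_add_swap e i j k p]
  -- Each point brings the coordinate frame of its own chart, so no frame on `U` and no gluing is
  -- needed.
  · have he (p : U) := isLocalFrameOn_coordVector (n := n) (p : M)
    have hV (p : U) := (chartAt (EuclideanSpace ℝ (Fin n)) (p : M)).open_source
    have hp (p : U) := mem_chart_source (EuclideanSpace ℝ (Fin n)) (p : M)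
    obtain ⟨N, hN⟩ := MDD.exists_connectionCoeff_eq (g := g) _ _ he hV hp
      (fun i j k p ↦ g.leviCivitaCoeff (coordVector (p : M)) i j k p)
      (fun i j k p ↦ g.leviCivitaCoeff_add_swap _ i j k p)
    have hNt : N.IsTorsionFree := N.isTorsionFree_iff.2 fun p ↦
      ((N.isDerivativeAt p).torsion_eq_zero_iff (he p) (hV p) (hp p)).2 (hN p)
    refine ⟨N, hNt, fun D hD ↦ ?_, ?_, fun V hVU e heV ↦ ?_⟩
    · refine MDD.eq_of_connectionCoeff_eq _ _ he hV hp fun p i j k ↦ ?_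
      rw [hN]
      exact ((D.isDerivativeAt p).torsion_eq_zero_iff (he p) (hV p) (hp p)).1
        (D.isTorsionFree_iff.1 hD p) i j k
    · refine N.preservesSmoothness_of_frames _ _ he hV hp fun p i j k ↦ ?_
      refine (g.scalarSmoothNear_leviCivitaCoeff (he p) (hV p) (hp p) i j k).congr ?_
      filter_upwards [U.isOpen.mem_nhds p.2, (hV p).mem_nhds (hp p)] with q hq hqV
      -- At `q` near `p`, `N` was defined by the chart at `q`; vanishing torsion shows that its
      -- coefficients in the frame of the chart at `p` are the Levi-Civita ones as well.
      refine ((N.isDerivativeAt_extend hq).torsion_eq_zero_iff (he p) (hV p) hqV).1 ?_ i j k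
      have := N.isTorsionFree_iff.1 hNt ⟨q, hq⟩
      rwa [← N.extend_coe] at this
    · have h : (N.restrict hVU).HasConnectionCoeffs e
          (fun i j k p ↦ g.leviCivitaCoeff e i j k p) := by
        rw [hasConnectionCoeffs_iff heV, ← isTorsionFree_iff_connectionCoeff heV]
        exact fun p ↦ hNt ⟨p, hVU p.2⟩
      refine ⟨?_, h⟩
      simpa only [HasContorsionCoeffs, add_zero] using h
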